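/- Let $\lambda_-<\lambda_+$ and let $\Lambda\in C^2(\mathbb R,(\lambda_-,\lambda_+))$ satisfy $\Lambda(s)\to\lambda_\pm$ and $\Lambda'(s)\to 0$ as $s\to\pm\infty$ (a \emph{parameter shift}). Let $a,b:[\lambda_-,\lambda_+]\to\mathbb R$ be $C^2$ functions with $b(\lambda)>-1$ and $|a(\lambda)|<\sqrt{b(\lambda)+1}$ for all $\lambda\in[\lambda_-,\lambda_+]$. For $x=(x_1,x_2)\in\mathbb R^2$ put $$F(x,\lambda)=\bigl(-x_1^3+a(\lambda)x_1^2+b(\lambda)x_1-a(\lambda)(b(\lambda)+1)+x_2,\; x_1-x_2\bigr),$$ and for $r>0$ consider the system $\dot x=F(x,\Lambda(rt))$. Put $p_1(s)=-\sqrt{b(\Lambda(s))+1}\,(1,1)$ and $p_3(s)=\sqrt{b(\Lambda(s))+1}\,(1,1)$, with limits $p_{i\pm}=\lim_{s\to\pm\infty}p_i(s)$. \emph{Definitions.} An equilibrium of $\dot x=F(x,\lambda)$ is \emph{attracting} if all eigenvalues of the linearization have negative real part. A \emph{stable path} is a continuous path $(X(s),\Lambda(s))$ such that $X(s)$ is an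 attracting equilibrium of $\dot x=F(x,\Lambda(s))$ for every $s$, and such that the limits $X_\pm=\lim_{s\to\pm\infty}X(s)$ exist and are attracting equilibria of $\dot x=F(x,\lambda_\pm)$. The \emph{pullback attractor} to $X_-$ at rate $r$ is the unique trajectory $x^r:\mathbb R\to\mathbb R^2$ of $\dot x=F(x,\Lambda(rt))$ with $x^r(t)\to X_-$ as $t\to-\infty$. There is \emph{R-tipping} away from $X_-$ for $\Lambda$ at rate $r$ if the pullback attractor exists and $x^r(t)\not\to X_+$ as $t\to\infty$; there is \emph{no R-tipping} away from $(X_-,\lambda_-)$ if for every $r>0$ the pullback attractor exists and $x^r(t)\to X_+$ as $t\to\infty$. \emph{There can be R-tipping} away from $X_-$ if there is a $C^2$ function $\sigma:\mathbb R\to\mathbb R$ with $\sigma'>0$ and $\sigma(s)\to\pm\infty$ as $s\to\pm\infty$, such that $\tilde\Lambda=\Lambda\circ\sigma$ is again a parameter shift with limits $\lambda_\pm$, and for $\tilde\Lambda$ there is R-tipping away from $X_-$ at some rate $r>0$. The stable path $(X(s),\Lambda(s))$ is \emph{forward inflowing stable} if there are compact sets $K(s)\subset\mathbb R^2$, $s\in\mathbb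 R$, such that: $X(s)\in\operatorname{Int}K(s)$ for all $s$; $K(s_1)\subset K(s_2)$ for $s_1<s_2$; for $x\in\partial K(s)$ the vector $v=F(x,\Lambda(s))$ points strictly into $K(s)$, i.e. there is $\delta>0$ with $x+hw\in K(s)$ whenever $0<h<\delta$ and $|w-v|<\delta$; with $K_-=\bigcap_s K(s)$ and $K_+=\overline{\bigcup_s K(s)}$ one has $X_\pm\in\operatorname{Int}K_\pm$; and $K_+$ is compact and contained in the basin of attraction of $X_+$ for $\dot x=F(x,\lambda_+)$. \emph{Claim.} \begin{enumerate} \item If there are $s_1<s_2$ with $-\sqrt{b(\Lambda(s_1))+1}>a(\Lambda(s_2))$ (resp. $\sqrt{b(\Lambda(s_1))+1}<a(\Lambda(s_2))$), then $(p_1(s),\Lambda(s))$ (resp. $(p_3(s),\Lambda(s))$) is a stable path and there can be R-tipping away from $p_{1-}$ (resp. $p_{3-}$). \item If $-\sqrt{b(\Lambda(s_1))+1}<a(\Lambda(s_2))$ (resp. $\sqrt{b(\Lambda(s_1))+1}>a(\Lambda(s_2))$) for all $-\infty\le s_1<s_2\le+\infty$, where $\Lambda(\pm\infty)=\lambda_\pm$,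 then $(p_1(s),\Lambda(s))$ (resp. $(p_3(s),\Lambda(s))$) is forward inflowing stable and there is no R-tipping away from $(p_{1-},\lambda_-)$ (resp. $(p_{3-},\lambda_-)$). \end{enumerate} -/

import Mathlib

open Filter Topology Set

noncomputable section

namespace RTipping

section General

variable {E : Type*} [NormedAddCommGroup E] [NormedSpace ℝ E]

/-- A parameter shift: a `C²` map `Λ : ℝ → (lm, lp)` with `Λ(s) → lm, lp` and `Λ'(s) → 0`
as `s → -∞, +∞`. -/
structure IsParameterShift (Λ : ℝ → ℝ) (lm lp : ℝ) : Prop where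
  contDiff : ContDiff ℝ 2 Λ
  mem_Ioo : ∀ s, Λ s ∈ Ioo lm lp
  tendsto_atBot : Tendsto Λ atBot (𝓝 lm)
  tendsto_atTop : Tendsto Λ atTop (𝓝 lp)
  deriv_atBot : Tendsto (deriv Λ) atBot (𝓝 0)
  deriv_atTop : Tendsto (deriv Λ) atTop (𝓝 0)

/-- `σ` is an admissible change of time scale: an increasing `C²` diffeomorphism of `ℝ`. -/
structure IsRescaling (σ : ℝ → ℝ) : Prop where
  contDiff : ContDiff ℝ 2 σ
  deriv_pos : ∀ s, 0 < deriv σ s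
  tendsto_atBot : Tendsto σ atBot atBot
  tendsto_atTop : Tendsto σ atTop atTop

/-- `x` is an attracting equilibrium of `ẋ = f(x, l)`: a zero of `f(·, l)` at which all (complex)
eigenvalues of the linearization have negative real part. -/
def IsAttractingEquilibrium [FiniteDimensional ℝ E] (f : E → ℝ → E) (l : ℝ) (x : E) : Prop :=
  f x l = 0 ∧ ∃ A : E →L[ℝ] E, HasFDerivAt (fun y => f y l) A x ∧
    ∀ μ : ℂ, ((A : E →ₗ[ℝ] E).charpoly.map (algebraMap ℝ ℂ)).IsRoot μ → μ.re < 0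

/-- `(X(s), Λ(s))` is a stable path with end points `Xm`, `Xp`: a continuous path of attracting
equilibria which converges, as `s → -∞, +∞`, to attracting equilibria `Xm`, `Xp` of the limiting
systems. -/
structure IsStablePath [FiniteDimensional ℝ E] (f : E → ℝ → E) (Λ : ℝ → ℝ) (lm lp : ℝ)
    (X : ℝ → E) (Xm Xp : E) : Prop where
  continuous : Continuous X
  attracting : ∀ s, IsAttractingEquilibrium f (Λ s) (X s)
  tendsto_atBot : Tendsto X atBot (𝓝 Xm)
  tendsto_atTop : Tendsto X atTop (𝓝 Xp)
  attracting_atBot : IsAttractingEquilibrium f lm Xm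
  attracting_atTop : IsAttractingEquilibrium f lp Xp

/-- The basin of attraction of `p` for `ẋ = f(x, l)`: the points whose forward solution exists for
all times `t ≥ 0` and converges to `p`. -/
def basin (f : E → ℝ → E) (l : ℝ) (p : E) : Set E :=
  {x₀ | ∃ φ : ℝ → E, φ 0 = x₀ ∧
    (∀ t, 0 ≤ t → HasDerivWithinAt φ (f (φ t) l) (Ici 0) t) ∧ Tendsto φ atTop (𝓝 p)}

/-- The vector `v`, attached at `x`, points strictly into `K`: moving a short way from `x` along
any direction close to `v` leads into `K`. -/
def PointsStrictlyInto (K : Set E) (x v : E) : Prop :=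
  ∃ δ > 0, ∀ h ∈ Ioo (0 : ℝ) δ, ∀ w ∈ Metric.ball v δ, x + h • w ∈ K

/-- Forward inflowing stability of the stable path `(X(s), Λ(s))`. -/
def IsForwardInflowingStable [FiniteDimensional ℝ E] (f : E → ℝ → E) (Λ : ℝ → ℝ) (lm lp : ℝ)
    (X : ℝ → E) (Xm Xp : E) : Prop :=
  IsStablePath f Λ lm lp X Xm Xp ∧
  ∃ K : ℝ → Set E,
    (∀ s, IsCompact (K s)) ∧
    (∀ s, X s ∈ interior (K s)) ∧
    (∀ s₁ s₂, s₁ < s₂ → K s₁ ⊆ K s₂) ∧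
    (∀ s, ∀ x ∈ frontier (K s), PointsStrictlyInto (K s) x (f x (Λ s))) ∧
    Xm ∈ interior (⋂ s, K s) ∧
    Xp ∈ interior (closure (⋃ s, K s)) ∧
    IsCompact (closure (⋃ s, K s)) ∧
    closure (⋃ s, K s) ⊆ basin f lp Xp

/-- `x` is a trajectory of `ẋ = f(x, Λ(rt))`, defined for all times, with `x(t) → Xm` as
`t → -∞`. -/
def EmanatesFrom (f : E → ℝ → E) (Λ : ℝ → ℝ) (r : ℝ) (Xm : E) (x : ℝ → E) : Prop :=
  (∀ t, HasDerivAt x (f (x t) (Λ (r * t))) t) ∧ Tendsto x atBot (𝓝 Xm)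

/-- `x` is the local pullback attractor to `Xm` of `ẋ = f(x, Λ(rt))`: the unique trajectory
with `x(t) → Xm` as `t → -∞`. -/
def IsPullbackAttractor (f : E → ℝ → E) (Λ : ℝ → ℝ) (r : ℝ) (Xm : E) (x : ℝ → E) : Prop :=
  EmanatesFrom f Λ r Xm x ∧ ∀ y, EmanatesFrom f Λ r Xm y → y = x

/-- R-tipping away from `Xm` for the parameter shift `Λ` at the rate `r`: the pullback
attractor to `Xm` exists and does not converge to `Xp`. -/
def RTips (f : E → ℝ → E) (Λ : ℝ → ℝ) (r : ℝ) (Xm Xp : E) : Prop :=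
  ∃ x, IsPullbackAttractor f Λ r Xm x ∧ ¬ Tendsto x atTop (𝓝 Xp)

/-- Endpoint tracking for the parameter shift `Λ` at the rate `r`: the pullback attractor to
`Xm` exists and converges to `Xp`. -/
def EndpointTracks (f : E → ℝ → E) (Λ : ℝ → ℝ) (r : ℝ) (Xm Xp : E) : Prop :=
  ∃ x, IsPullbackAttractor f Λ r Xm x ∧ Tendsto x atTop (𝓝 Xp)

/-- There can be R-tipping away from the stable path `(X(s), Λ(s))`: some rescaling `Λ ∘ σ` of
the parameter shift is a parameter shift for which there is R-tipping at some rate `r > 0`. -/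
def RTippingPossible [FiniteDimensional ℝ E] (f : E → ℝ → E) (Λ : ℝ → ℝ) (lm lp : ℝ)
    (X : ℝ → E) (Xm Xp : E) : Prop :=
  IsStablePath f Λ lm lp X Xm Xp ∧
  ∃ σ : ℝ → ℝ, IsRescaling σ ∧ IsParameterShift (Λ ∘ σ) lm lp ∧
    ∃ r > 0, RTips f (Λ ∘ σ) r Xm Xp

/-- There is no R-tipping: the pullback attractor endpoint tracks at every rate `r > 0`. -/
def NoRTipping (f : E → ℝ → E) (Λ : ℝ → ℝ) (Xm Xp : E) : Prop :=
  ∀ r > 0, EndpointTracks f Λ r Xm Xp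

end General

/-- The planar vector field `F(x, l)`, with coefficients `a(l)` and `b(l)`. -/
def F (a b : ℝ → ℝ) (x : EuclideanSpace ℝ (Fin 2)) (l : ℝ) : EuclideanSpace ℝ (Fin 2) :=
  !₂[-(x 0) ^ 3 + a l * (x 0) ^ 2 + b l * x 0 - a l * (b l + 1) + x 1, x 0 - x 1]

/-- The lower equilibrium `p₁ = (-√(b+1), -√(b+1))`. -/
def p₁ (b : ℝ → ℝ) (l : ℝ) : EuclideanSpace ℝ (Fin 2) :=
  !₂[-√(b l + 1), -√(b l + 1)]

/-- The upper equilibrium `p₃ = (√(b+1), √(b+1))`. -/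
def p₃ (b : ℝ → ℝ) (l : ℝ) : EuclideanSpace ℝ (Fin 2) :=
  !₂[√(b l + 1), √(b l + 1)]

end RTipping

end

/-! With `c = √(b+1)` the vector field reads `u' = cubic u - u + v`, `v' = u - v`, and `cubic` has
the zeros `-c < a < c`: the equilibria are the diagonal points over these zeros, two sinks with a
saddle between them. The system is cooperative, so a quadrant `u < k`, `v < k + e` is forward
invariant as soon as `cubic k + e < 0 < e`, even for a moving `k` that does not fall too fast. This
is `lt_barrier`; it reduces the planar problem to the position of a scalar barrier relative to the
three zeros.

The pullback attractor exists and is unique because the equation contracts distances near the sink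
in the far past (`exists_solvesAt_tendsto_atBot`, `eq_of_solvesAt_of_tendsto_atBot`).

No tipping from `p₁`: the hypothesis says that no past position of `-c` reaches a present or future
position of the saddle. By compactness of `[-∞, ∞]` the gap is uniform, so the running supremum of
`-c`, raised slightly, is a nondecreasing barrier below the saddle (`exists_isSeparating`). Being
monotone, it confines the trajectory whatever the rate. The boxes under it are the inflowing sets,
and whatever stays below the saddle of the limit system converges to its lower sink
(`tendsto_neg_of_lt_saddle`).

Tipping from `p₃`: drift slowly up to `s₁`, so that the trajectory stays just above `c(Λ s₁)` at
most; rush to `s₂` so briefly that it hardly moves; it is then below the saddle `a(Λ s₂)`, and a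
second slow drift keeps it there (`rTippingPossible_p₃`).

The reflection `x ↦ -x`, `a ↦ -a` exchanges `p₁` and `p₃` and yields the two remaining cases. -/

open Filter Topology Set

noncomputable section

namespace RTipping

/-! ### Global solutions of bounded Lipschitz equations -/

/-- A field bounded by `L` moves a point at most `L * (n + 1)` in time `n + 1`, so Picard–Lindelöf
applies on every interval about `t₀`. Uniqueness makes these solutions agree on overlaps. -/
theorem exists_forall_hasDerivAt_of_lipschitz_of_bounded {E : Type*} [NormedAddCommGroup E]
    [NormedSpace ℝ E] [CompleteSpace E] {f : ℝ → E → E} {K L : NNReal}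
    (hK : ∀ t, LipschitzWith K (f t)) (hc : ∀ x, Continuous fun t => f t x)
    (hL : ∀ t x, ‖f t x‖ ≤ L) (t₀ : ℝ) (x₀ : E) :
    ∃ x : ℝ → E, x t₀ = x₀ ∧ ∀ t, HasDerivAt x (f t (x t)) t := by
  have hloc : ∀ n : ℕ, ∃ x : ℝ → E, x t₀ = x₀ ∧
      ∀ t ∈ Ioo (t₀ - (n + 1)) (t₀ + (n + 1)), HasDerivAt x (f t (x t)) t := by
    intro n
    have hn : (0 : ℝ) ≤ n := n.cast_nonneg
    have hPL : IsPicardLindelof f (tmin := t₀ - (n + 1)) (tmax := t₀ + (n + 1))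
        ⟨t₀, by constructor <;> linarith⟩ x₀ (L * (n + 1)) 0 L K :=
      { lipschitzOnWith := fun t _ => (hK t).lipschitzOnWith
        continuousOn := fun x _ => (hc x).continuousOn
        norm_le := fun t _ x _ => hL t x
        mul_max_le := by simp }
    obtain ⟨x, hx0, hx⟩ := hPL.exists_eq_forall_mem_Icc_hasDerivWithinAt₀
    exact ⟨x, hx0, fun t ht => (hx t (Ioo_subset_Icc_self ht)).hasDerivAt (Icc_mem_nhds ht.1 ht.2)⟩
  choose X hX0 hX using hloc
  have hEq : ∀ m n : ℕ, m ≤ n → EqOn (X m) (X n) (Ioo (t₀ - (m + 1)) (t₀ + (m + 1))) := by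
    intro m n hmn
    have h : (m : ℝ) ≤ n := by exact_mod_cast hmn
    have hm : (0 : ℝ) ≤ m := m.cast_nonneg
    refine ODE_solution_unique_of_mem_Ioo (v := f) (s := fun _ => univ) (K := K) (t₀ := t₀)
      (fun t _ => (hK t).lipschitzOnWith) (by constructor <;> linarith)
      (fun t ht => ⟨hX m t ht, trivial⟩)
      (fun t ht => ⟨hX n t ⟨by linarith [ht.1], by linarith [ht.2]⟩, trivial⟩) ?_
    rw [hX0, hX0]
  refine ⟨fun t => X ⌈|t - t₀|⌉₊ t, by simp [hX0], fun t => ?_⟩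
  set N := ⌈|t - t₀|⌉₊ with hN
  have key : ∀ s ∈ Ioo (t₀ - (N + 1 : ℝ)) (t₀ + (N + 1)), X ⌈|s - t₀|⌉₊ s = X N s := by
    intro s hs
    have hs' : |s - t₀| ≤ ⌈|s - t₀|⌉₊ := Nat.le_ceil _
    rw [abs_le] at hs'
    rcases le_total ⌈|s - t₀|⌉₊ N with h | h
    · exact hEq _ _ h ⟨by linarith [hs'.1], by linarith [hs'.2]⟩
    · exact (hEq _ _ h hs).symm
  have ht' : |t - t₀| ≤ N := Nat.le_ceil _
  rw [abs_le] at ht'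
  have htm : t ∈ Ioo (t₀ - (N + 1 : ℝ)) (t₀ + (N + 1)) :=
    ⟨by linarith [ht'.1], by linarith [ht'.2]⟩
  refine (hX N t htm).congr_of_eventuallyEq ?_
  filter_upwards [Ioo_mem_nhds htm.1 htm.2] with s hs using key s hs

/-! ### The planar system in coordinates -/

/-- The cubic `-(u - α)(u² - (β + 1))`, whose zeros are the equilibria. -/
def cubic (α β u : ℝ) : ℝ := -(u - α) * (u ^ 2 - (β + 1))

/-- At time `t` the pair `(u, v)` solves `u' = cubic α β u - u + v`, `v' = u - v`. -/
def SolvesAt (α β u v : ℝ → ℝ) (t : ℝ) : Prop :=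
  HasDerivAt u (cubic (α t) (β t) (u t) - u t + v t) t ∧ HasDerivAt v (u t - v t) t

theorem cubic_neg (α β u : ℝ) : cubic (-α) β (-u) = -cubic α β u := by
  unfold cubic; ring

theorem SolvesAt.neg {α β u v : ℝ → ℝ} {t : ℝ} (h : SolvesAt α β u v t) :
    SolvesAt (-α) β (-u) (-v) t := by
  refine ⟨h.1.neg.congr_deriv ?_, h.2.neg.congr_deriv ?_⟩
  · simp only [Pi.neg_apply, cubic_neg]; ring
  · simp only [Pi.neg_apply]; ring

/-! ### A priori bounds and existence forward in time -/

theorem cubic_le_neg_two {A B α β M : ℝ} (hα : |α| ≤ A) (hβ : |β| ≤ B) (hM : A + B + 2 ≤ M) :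
    cubic α β M ≤ -2 := by
  rw [abs_le] at hα hβ
  have h1 : 2 ≤ M - α := by linarith
  have h2 : 1 ≤ M ^ 2 - (β + 1) := by nlinarith
  unfold cubic
  nlinarith

theorem two_le_cubic_neg {A B α β M : ℝ} (hα : |α| ≤ A) (hβ : |β| ≤ B) (hM : A + B + 2 ≤ M) :
    2 ≤ cubic α β (-M) := by
  have h := cubic_le_neg_two (α := -α) (by rwa [abs_neg]) hβ hM
  have := cubic_neg (-α) β M
  rw [neg_neg] at this
  linarith

/-- Truncation to `[-M, M]`. -/
def clip (M u : ℝ) : ℝ := max (-M) (min u M)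

theorem abs_clip_le {M : ℝ} (hM : 0 ≤ M) (u : ℝ) : |clip M u| ≤ M := by
  unfold clip
  exact abs_le.2 ⟨le_max_left _ _, max_le (by linarith) (min_le_right _ _)⟩

theorem clip_of_le {M u : ℝ} (h : |u| ≤ M) : clip M u = u := by
  rw [abs_le] at h
  unfold clip
  rw [min_eq_left h.2, max_eq_right h.1]

theorem clip_of_ge {M u : ℝ} (hM : 0 ≤ M) (h : M ≤ u) : clip M u = M := by
  unfold clip
  rw [min_eq_right h, max_eq_right (by linarith)]

theorem clip_of_le_neg {M u : ℝ} (hM : 0 ≤ M) (h : u ≤ -M) : clip M u = -M := by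
  unfold clip
  rw [min_eq_left (by linarith), max_eq_left h]

theorem abs_clip_sub_clip_le (M u w : ℝ) : |clip M u - clip M w| ≤ |u - w| := by
  unfold clip
  refine (abs_max_sub_max_le_max _ _ _ _).trans ?_
  rw [sub_self, abs_zero]
  refine max_le (abs_nonneg _) ((abs_min_sub_min_le_max _ _ _ _).trans ?_)
  simp

theorem abs_cubic_le {A B α β M u : ℝ} (hα : |α| ≤ A) (hβ : |β| ≤ B) (hu : |u| ≤ M) :
    |cubic α β u| ≤ (M + A) * (M ^ 2 + B + 1) := by
  unfold cubic
  rw [abs_mul, abs_neg]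
  have h1 : |u - α| ≤ M + A := (abs_sub _ _).trans (add_le_add hu hα)
  have h2 : |u ^ 2 - (β + 1)| ≤ M ^ 2 + B + 1 := by
    rw [abs_le] at *
    constructor <;> nlinarith
  exact mul_le_mul h1 h2 (abs_nonneg _) ((abs_nonneg _).trans h1)

theorem cubic_sub_cubic (α β u w : ℝ) : cubic α β u - cubic α β w =
    (-(u ^ 2 + u * w + w ^ 2) + α * (u + w) + (β + 1)) * (u - w) := by
  unfold cubic; ring

theorem abs_cubic_sub_cubic_le {A B α β M u w : ℝ} (hα : |α| ≤ A) (hβ : |β| ≤ B) (hu : |u| ≤ M)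
    (hw : |w| ≤ M) :
    |cubic α β u - cubic α β w| ≤ (3 * M ^ 2 + 2 * A * M + B + 1) * |u - w| := by
  rw [cubic_sub_cubic, abs_mul]
  refine mul_le_mul_of_nonneg_right ?_ (abs_nonneg _)
  have hA : 0 ≤ A := (abs_nonneg _).trans hα
  have h1 : |α * (u + w)| ≤ A * (2 * M) := by
    rw [abs_mul]
    exact mul_le_mul hα ((abs_add_le _ _).trans (by linarith)) (abs_nonneg _) hA
  rw [abs_le] at *
  constructor <;> nlinarith

/-- The field truncated to `|u| ≤ M`, `|v| ≤ M + 1` is bounded and Lipschitz, hence has global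
solutions. The box is forward invariant, so for `t ≥ t₀` the truncation is never felt. On the sides
`u = ±M` the cubic pushes inward with strength at least `2`, which beats the coupling of at most
`1`. -/
theorem exists_forall_ge_solvesAt {α β : ℝ → ℝ} {A B : ℝ} (hαc : Continuous α) (hβc : Continuous β)
    (hα : ∀ t, |α t| ≤ A) (hβ : ∀ t, |β t| ≤ B) (t₀ u₀ v₀ : ℝ) :
    ∃ u v : ℝ → ℝ, u t₀ = u₀ ∧ v t₀ = v₀ ∧ ∀ t, t₀ ≤ t → SolvesAt α β u v t := by
  have hA : 0 ≤ A := (abs_nonneg _).trans (hα 0)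
  have hB : 0 ≤ B := (abs_nonneg _).trans (hβ 0)
  set M : ℝ := A + B + 2 + |u₀| + |v₀| with hMdef
  have hM0 : 0 ≤ M := by positivity
  have hM : A + B + 2 ≤ M := by linarith [abs_nonneg u₀, abs_nonneg v₀]
  have hu₀ : |u₀| ≤ M := by linarith [abs_nonneg u₀, abs_nonneg v₀]
  have hv₀ : |v₀| ≤ M + 1 := by linarith [abs_nonneg u₀, abs_nonneg v₀]
  set f : ℝ → ℝ × ℝ → ℝ × ℝ := fun t x =>
    (cubic (α t) (β t) (clip M x.1) - clip M x.1 + clip (M + 1) x.2,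
      clip M x.1 - clip (M + 1) x.2) with hf
  obtain ⟨Q, hQ⟩ : ∃ Q : NNReal, (Q : ℝ) = 3 * M ^ 2 + 2 * A * M + B + 1 + 2 :=
    ⟨⟨_, by positivity⟩, rfl⟩
  obtain ⟨R, hR⟩ : ∃ R : NNReal, (R : ℝ) = (M + A) * (M ^ 2 + B + 1) + M + (M + 1) :=
    ⟨⟨_, by positivity⟩, rfl⟩
  have hlip : ∀ t, LipschitzWith Q (f t) := by
    intro t
    refine LipschitzWith.of_dist_le_mul fun x y => ?_
    have h1 : |x.1 - y.1| ≤ dist x y := by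
      rw [Prod.dist_eq, ← Real.dist_eq]; exact le_max_left _ _
    have h2 : |x.2 - y.2| ≤ dist x y := by
      rw [Prod.dist_eq, ← Real.dist_eq]; exact le_max_right _ _
    have h3 := (abs_clip_sub_clip_le M x.1 y.1).trans h1
    have h4 := (abs_clip_sub_clip_le (M + 1) x.2 y.2).trans h2
    have h5 := abs_cubic_sub_cubic_le (hα t) (hβ t) (abs_clip_le hM0 x.1) (abs_clip_le hM0 y.1)
    have h6 : |cubic (α t) (β t) (clip M x.1) - cubic (α t) (β t) (clip M y.1)| ≤
        (3 * M ^ 2 + 2 * A * M + B + 1) * dist x y :=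
      h5.trans (mul_le_mul_of_nonneg_left h3 (by positivity))
    have h7 : 0 ≤ (3 * M ^ 2 + 2 * A * M + B + 1) * dist x y := by positivity
    rw [hQ, Prod.dist_eq, Real.dist_eq, Real.dist_eq]
    simp only [hf]
    rw [abs_le] at h3 h4 h6
    refine max_le (abs_le.2 ⟨?_, ?_⟩) (abs_le.2 ⟨?_, ?_⟩) <;> linarith
  have hbd : ∀ t x, ‖f t x‖ ≤ R := by
    intro t x
    have h1 := abs_clip_le hM0 x.1
    have h2 := abs_clip_le (show 0 ≤ M + 1 by linarith) x.2
    have h3 := abs_cubic_le (hα t) (hβ t) h1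
    have h4 : 0 ≤ (M + A) * (M ^ 2 + B + 1) := by positivity
    rw [hR, Prod.norm_def, Real.norm_eq_abs, Real.norm_eq_abs]
    simp only [hf]
    rw [abs_le] at h1 h2 h3
    refine max_le (abs_le.2 ⟨?_, ?_⟩) (abs_le.2 ⟨?_, ?_⟩) <;> linarith
  have hcont : ∀ x, Continuous fun t => f t x := by
    intro x
    simp only [hf, cubic]
    fun_prop
  obtain ⟨x, hx0, hx⟩ := exists_forall_hasDerivAt_of_lipschitz_of_bounded hlip hcont hbd t₀ (u₀, v₀)
  have hx1 : ∀ t, HasDerivAt (fun s => (x s).1) (f t (x t)).1 t := fun t => (hx t).fst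
  have hx2 : ∀ t, HasDerivAt (fun s => (x s).2) (f t (x t)).2 t := fun t => (hx t).snd
  have fence : ∀ (w w' : ℝ → ℝ) (k : ℝ), (∀ t, HasDerivAt w (w' t) t) → w t₀ ≤ k →
      (∀ t, w t = k → w' t < 0) → ∀ t, t₀ ≤ t → w t ≤ k := by
    intro w w' k hw hw0 hb t ht
    exact image_le_of_deriv_right_lt_deriv_boundary (a := t₀) (b := t) (B := fun _ => k)
      (B' := fun _ => 0) (fun s _ => (hw s).continuousAt.continuousWithinAt)
      (fun s _ => (hw s).hasDerivWithinAt) hw0 (fun s => hasDerivAt_const s k)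
      (fun s _ => hb s) ⟨ht, le_rfl⟩
  have e0 : (x t₀).1 = u₀ := by rw [hx0]
  have e1 : (x t₀).2 = v₀ := by rw [hx0]
  have hclip2 : ∀ t, |clip (M + 1) (x t).2| ≤ M + 1 := fun t => abs_clip_le (by linarith) _
  have hclip1 : ∀ t, |clip M (x t).1| ≤ M := fun t => abs_clip_le hM0 _
  have hu : ∀ t, t₀ ≤ t → |(x t).1| ≤ M := by
    intro t ht
    rw [abs_le] at hu₀ ⊢
    have hlow := fence (fun s => -(x s).1) _ M (fun s => (hx1 s).neg) (by simp only [e0]; linarith)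
      (fun s hs => by
        have : clip M (x s).1 = -M := clip_of_le_neg hM0 (by linarith)
        have h2 := abs_le.1 (hclip2 s)
        simp only [hf, this]
        linarith [two_le_cubic_neg (hα s) (hβ s) hM]) t ht
    have hupp := fence (fun s => (x s).1) _ M hx1 (by simp only [e0]; linarith)
      (fun s hs => by
        have : clip M (x s).1 = M := clip_of_ge hM0 hs.ge
        have h2 := abs_le.1 (hclip2 s)
        simp only [hf, this]
        linarith [cubic_le_neg_two (hα s) (hβ s) hM]) t ht
    exact ⟨by linarith, hupp⟩
  have hv : ∀ t, t₀ ≤ t → |(x t).2| ≤ M + 1 := by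
    intro t ht
    rw [abs_le] at hv₀ ⊢
    have hlow := fence (fun s => -(x s).2) _ (M + 1) (fun s => (hx2 s).neg)
      (by simp only [e1]; linarith)
      (fun s hs => by
        have : clip (M + 1) (x s).2 = -(M + 1) := clip_of_le_neg (by linarith) (by linarith)
        have h2 := abs_le.1 (hclip1 s)
        simp only [hf, this]
        linarith) t ht
    have hupp := fence (fun s => (x s).2) _ (M + 1) hx2 (by simp only [e1]; linarith)
      (fun s hs => by
        have : clip (M + 1) (x s).2 = M + 1 := clip_of_ge (by linarith) hs.ge
        have h2 := abs_le.1 (hclip1 s)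
        simp only [hf, this]
        linarith) t ht
    exact ⟨by linarith, hupp⟩
  refine ⟨fun s => (x s).1, fun s => (x s).2, e0, e1, fun t ht => ?_⟩
  refine ⟨(hx1 t).congr_deriv ?_, (hx2 t).congr_deriv ?_⟩
  · simp only [hf, clip_of_le (hu t ht), clip_of_le (hv t ht)]
  · simp only [hf, clip_of_le (hu t ht), clip_of_le (hv t ht)]

/-! ### Comparison with barriers -/

/-- A function that reaches its barrier `k` from below at `τ` does so with slope at least `-κ`,
if `k` decreases at most at the rate `κ`. -/
theorem neg_le_deriv_of_le_barrier {w k : ℝ → ℝ} {w' κ t₀ τ : ℝ} (hτ : t₀ < τ)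
    (hw : HasDerivAt w w' τ) (hk : ∀ t, t₀ ≤ t → t ≤ τ → k t - k τ ≤ κ * (τ - t))
    (hle : ∀ t, t₀ ≤ t → t < τ → w t ≤ k t) (heq : w τ = k τ) : -κ ≤ w' := by
  have hlim : Tendsto (slope w τ) (𝓝[<] τ) (𝓝 w') :=
    (hasDerivAt_iff_tendsto_slope.1 hw).mono_left (nhdsWithin_mono _ fun t ht => ne_of_lt ht)
  refine ge_of_tendsto hlim ?_
  filter_upwards [Ioo_mem_nhdsLT hτ] with t ht
  have h1 := hle t ht.1.le ht.2
  have h2 := hk t ht.1.le ht.2.le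
  rw [slope_def_field, le_div_iff_of_neg (by linarith [ht.2])]
  linarith

/-- Upper barriers `k` for `u` and `k + e` for `v`. -/
theorem lt_barrier {α β u v k : ℝ → ℝ} {t₀ t₁ κ e : ℝ}
    (hsol : ∀ t, t₀ ≤ t → t ≤ t₁ → SolvesAt α β u v t)
    (hk : ∀ s t, t₀ ≤ s → s ≤ t → t ≤ t₁ → k s - k t ≤ κ * (t - s))
    (he : κ < e) (hcub : ∀ t, t₀ ≤ t → t ≤ t₁ → cubic (α t) (β t) (k t) + e < -κ)
    (hu : u t₀ < k t₀) (hv : v t₀ < k t₀ + e) :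
    ∀ t, t₀ ≤ t → t ≤ t₁ → u t < k t ∧ v t < k t + e := by
  by_contra! hcon
  obtain ⟨t', ht'0, ht'1, ht'⟩ := hcon
  -- The times at which one of the two inequalities fails; the infimum `τ` is shown to be a time at
  -- which both hold, and hold a little longer.
  set S : Set ℝ := {t | t₀ ≤ t ∧ t ≤ t₁ ∧ (u t < k t → k t + e ≤ v t)} with hS
  have hne : S.Nonempty := ⟨t', ht'0, ht'1, ht'⟩
  have hbdd : BddBelow S := ⟨t₀, fun t ht => ht.1⟩
  set τ := sInf S with hτ
  have hτ0 : t₀ ≤ τ := le_csInf hne fun t ht => ht.1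
  have hτ1 : τ ≤ t₁ := (csInf_le hbdd ⟨ht'0, ht'1, ht'⟩).trans ht'1
  have hbefore : ∀ t, t₀ ≤ t → t < τ → u t < k t ∧ v t < k t + e := by
    intro t ht0 htτ
    by_contra hc
    exact absurd (csInf_le hbdd (show t ∈ S from ⟨ht0, by linarith, fun h =>
      not_lt.1 fun h' => hc ⟨h, h'⟩⟩)) (not_le.2 htτ)
  obtain ⟨hdu, hdv⟩ := hsol τ hτ0 hτ1
  have hle : u τ ≤ k τ ∧ v τ ≤ k τ + e := by
    rcases hτ0.eq_or_lt with h | h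
    · rw [← h]; exact ⟨hu.le, hv.le⟩
    -- `k` need not be continuous: it may jump upward. Only the bound `hk` on its decrease is
    -- available to pass to the limit.
    · have lim : ∀ (w : ℝ → ℝ) (d : ℝ), ContinuousAt w τ →
          (∀ t, t₀ ≤ t → t < τ → w t < k t + d) → w τ ≤ k τ + d := by
        intro w d hw hwk
        have h1 : Tendsto w (𝓝[<] τ) (𝓝 (w τ)) := hw.tendsto.mono_left nhdsWithin_le_nhds
        have h2 : Tendsto (fun t => k τ + κ * (τ - t) + d) (𝓝[<] τ)
            (𝓝 (k τ + κ * (τ - τ) + d)) := by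
          refine Tendsto.mono_left (Continuous.tendsto ?_ τ) nhdsWithin_le_nhds
          fun_prop
        have h3 := le_of_tendsto_of_tendsto h1 h2 (by
          filter_upwards [Ioo_mem_nhdsLT h] with t ht
          linarith [hwk t ht.1.le ht.2, hk t τ ht.1.le ht.2.le hτ1])
        simpa using h3
      refine ⟨?_, lim v e hdv.continuousAt fun t h1 h2 => (hbefore t h1 h2).2⟩
      simpa using lim u 0 hdu.continuousAt fun t h1 h2 => by simpa using (hbefore t h1 h2).1
  have hlt : u τ < k τ ∧ v τ < k τ + e := by
    rcases hτ0.eq_or_lt with h | h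
    · rw [← h]; exact ⟨hu, hv⟩
    refine ⟨lt_of_le_of_ne hle.1 fun heq => ?_, lt_of_le_of_ne hle.2 fun heq => ?_⟩
    -- Contact of `u` with `k` requires slope at least `-κ`, but `v ≤ k + e` gives `u' ≤ cubic k + e
    -- < -κ`. Likewise, contact of `v` with `k + e` meets `v' ≤ -e < -κ`.
    · have := neg_le_deriv_of_le_barrier h hdu (fun t h1 h2 => hk t τ h1 h2 hτ1)
        (fun t h1 h2 => (hbefore t h1 h2).1.le) heq
      have h3 := hcub τ hτ0 hτ1
      rw [heq] at this
      linarith [hle.2]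
    · have := neg_le_deriv_of_le_barrier (k := fun t => k t + e) (κ := κ) h hdv
        (fun t h1 h2 => by linarith [hk t τ h1 h2 hτ1])
        (fun t h1 h2 => (hbefore t h1 h2).2.le) heq
      linarith [hle.1]
  have hev : ∀ᶠ t in 𝓝[≥] τ, t ∉ S := by
    have aux : ∀ (w : ℝ → ℝ) (d : ℝ), ContinuousAt w τ → w τ < k τ + d →
        ∀ᶠ t in 𝓝 τ, w t + κ * (t - τ) < k τ + d := by
      intro w d hw hwk
      have : ContinuousAt (fun t => w t + κ * (t - τ)) τ := by fun_prop
      exact this.eventually_lt continuousAt_const (by simpa using hwk)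
    filter_upwards [self_mem_nhdsWithin,
      nhdsWithin_le_nhds (aux u 0 hdu.continuousAt (by simpa using hlt.1)),
      nhdsWithin_le_nhds (aux v e hdv.continuousAt hlt.2)] with t ht h1 h2 hmem
    have hkt := hk τ t hτ0 ht hmem.2.1
    exact absurd (hmem.2.2 (by linarith)) (by linarith)
  obtain ⟨b, hb, hbS⟩ := mem_nhdsGE_iff_exists_Ico_subset.1 hev
  obtain ⟨s, hs, hsb⟩ := exists_lt_of_csInf_lt hne (show sInf S < b from hb)
  exact hbS ⟨csInf_le hbdd hs, hsb⟩ hs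

/-- Solutions stay in the box `(-M, M) × (-(M + 1), M + 1)`. -/
theorem abs_lt_of_solvesAt {α β u v : ℝ → ℝ} {A B M t₀ : ℝ} (hα : ∀ t, |α t| ≤ A)
    (hβ : ∀ t, |β t| ≤ B) (hM : A + B + 2 ≤ M) (hsol : ∀ t, t₀ ≤ t → SolvesAt α β u v t)
    (hu : |u t₀| < M) (hv : |v t₀| < M + 1) :
    ∀ t, t₀ ≤ t → |u t| < M ∧ |v t| < M + 1 := by
  intro t ht
  rw [abs_lt] at hu hv
  have h1 := lt_barrier (k := fun _ => M) (t₁ := t) (κ := 0) (e := 1) (fun s h _ => hsol s h)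
    (by intros; simp) one_pos (fun s _ _ => by linarith [cubic_le_neg_two (hα s) (hβ s) hM])
    hu.2 hv.2 t ht le_rfl
  have h2 := lt_barrier (k := fun _ => M) (t₁ := t) (κ := 0) (e := 1)
    (fun s h _ => (hsol s h).neg)
    (by intros; simp) one_pos
    (fun s _ _ => by
      linarith [cubic_le_neg_two (α := (-α) s) (by simpa using hα s) (hβ s) hM])
    (by simp only [Pi.neg_apply]; linarith) (by simp only [Pi.neg_apply]; linarith) t ht le_rfl
  simp only [Pi.neg_apply] at h2
  exact ⟨abs_lt.2 ⟨by linarith, h1.1⟩, abs_lt.2 ⟨by linarith, h1.2⟩⟩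

/-! ### The squared distance of two solutions -/

theorem le_exp_mul_of_deriv_le {D D' : ℝ → ℝ} {c t₀ t₁ : ℝ} (h01 : t₀ ≤ t₁)
    (hD : ∀ t, t₀ ≤ t → t ≤ t₁ → HasDerivAt D (D' t) t)
    (hle : ∀ t, t₀ ≤ t → t ≤ t₁ → D' t ≤ c * D t) :
    D t₁ ≤ Real.exp (c * (t₁ - t₀)) * D t₀ := by
  have hder : ∀ t, t₀ ≤ t → t ≤ t₁ → HasDerivAt (fun s => Real.exp (-(c * s)) * D s)
      (Real.exp (-(c * t)) * (D' t - c * D t)) t := by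
    intro t h0 h1
    have he : HasDerivAt (fun s => Real.exp (-(c * s))) (Real.exp (-(c * t)) * (-c)) t := by
      have : HasDerivAt (fun s : ℝ => -(c * s)) (-c) t := by
        simpa [Function.comp_def] using (hasDerivAt_id t).const_mul (-c)
      exact this.exp
    exact (he.mul (hD t h0 h1)).congr_deriv (by ring)
  have hanti : AntitoneOn (fun s => Real.exp (-(c * s)) * D s) (Icc t₀ t₁) := by
    refine antitoneOn_of_deriv_nonpos (convex_Icc _ _)
      (fun t ht => (hder t ht.1 ht.2).continuousAt.continuousWithinAt)
      (fun t ht => ?_) (fun t ht => ?_)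
    · rw [interior_Icc] at ht
      exact (hder t ht.1.le ht.2.le).differentiableAt.differentiableWithinAt
    · rw [interior_Icc] at ht
      rw [(hder t ht.1.le ht.2.le).deriv]
      exact mul_nonpos_of_nonneg_of_nonpos (Real.exp_nonneg _)
        (by linarith [hle t ht.1.le ht.2.le])
  have h := hanti (left_mem_Icc.2 h01) (right_mem_Icc.2 h01) h01
  simp only at h
  have h2 : Real.exp (c * t₁) * (Real.exp (-(c * t₁)) * D t₁) ≤
      Real.exp (c * t₁) * (Real.exp (-(c * t₀)) * D t₀) :=
    mul_le_mul_of_nonneg_left h (Real.exp_nonneg _)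
  rw [← mul_assoc, ← mul_assoc, ← Real.exp_add, ← Real.exp_add] at h2
  simp only [add_neg_cancel, Real.exp_zero, one_mul] at h2
  rwa [show c * (t₁ - t₀) = c * t₁ + -(c * t₀) by ring]

/-- The difference quotient of `u ↦ cubic α β u - u`. -/
def cubicSlope (α β u w : ℝ) : ℝ := -(u ^ 2 + u * w + w ^ 2) + α * (u + w) + β

theorem hasDerivAt_sq_dist {α β u v w z : ℝ → ℝ} {t : ℝ} (h : SolvesAt α β u v t)
    (h' : SolvesAt α β w z t) :
    HasDerivAt (fun s => (u s - w s) ^ 2 + (v s - z s) ^ 2)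
      (2 * (cubicSlope (α t) (β t) (u t) (w t) * (u t - w t) ^ 2
        + 2 * (u t - w t) * (v t - z t) - (v t - z t) ^ 2)) t := by
  have h1 := ((h.1.sub h'.1).pow 2).add ((h.2.sub h'.2).pow 2)
  refine h1.congr_deriv ?_
  simp only [cubic, cubicSlope, Pi.sub_apply]
  norm_num
  ring

/-- A one-sided Lipschitz bound: the negative quadratic part absorbs `α * (u + w)`, so no bound on
`u` and `w` is needed. -/
theorem cubicSlope_le {A B α β u w : ℝ} (hα : |α| ≤ A) (hβ : |β| ≤ B) :
    cubicSlope α β u w ≤ A ^ 2 + B := by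
  have h2 : α ^ 2 ≤ A ^ 2 := sq_le_sq' (by linarith [(abs_le.1 hα).1]) (abs_le.1 hα).2
  rw [abs_le] at hβ
  unfold cubicSlope
  nlinarith [sq_nonneg (u + w - 2 * α), sq_nonneg (u - w), sq_nonneg (u + w), sq_nonneg α]

theorem sq_dist_le_exp_mul {α β u v w z : ℝ → ℝ} {A B t₀ t₁ : ℝ} (hα : ∀ t, |α t| ≤ A)
    (hβ : ∀ t, |β t| ≤ B) (h01 : t₀ ≤ t₁) (h : ∀ t, t₀ ≤ t → t ≤ t₁ → SolvesAt α β u v t)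
    (h' : ∀ t, t₀ ≤ t → t ≤ t₁ → SolvesAt α β w z t) :
    (u t₁ - w t₁) ^ 2 + (v t₁ - z t₁) ^ 2 ≤
      Real.exp (2 * (A ^ 2 + B + 1) * (t₁ - t₀)) *
        ((u t₀ - w t₀) ^ 2 + (v t₀ - z t₀) ^ 2) := by
  refine le_exp_mul_of_deriv_le (D := fun s => (u s - w s) ^ 2 + (v s - z s) ^ 2) h01
    (fun t h0 h1 => hasDerivAt_sq_dist (h t h0 h1) (h' t h0 h1)) fun t h0 h1 => ?_
  have h2 := mul_le_mul_of_nonneg_right (cubicSlope_le (u := u t) (w := w t) (hα t) (hβ t))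
    (sq_nonneg (u t - w t))
  have hB : 0 ≤ B := (abs_nonneg _).trans (hβ 0)
  nlinarith [sq_nonneg (u t - w t - (v t - z t)), sq_nonneg (v t - z t),
    mul_nonneg hB (sq_nonneg (v t - z t)),
    mul_nonneg (sq_nonneg A) (sq_nonneg (v t - z t))]

/-! ### Asymptotic upper bounds -/

/-- If `w` decreases at a definite rate whenever it is above `ℓ`, it is eventually below `ℓ`. -/
theorem eventually_le_of_deriv_le_neg {w w' : ℝ → ℝ} {δ ℓ m : ℝ} (hδ : 0 < δ)
    (hm : ∀ᶠ t in atTop, m ≤ w t) (hw : ∀ᶠ t in atTop, HasDerivAt w (w' t) t)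
    (hd : ∀ᶠ t in atTop, ℓ ≤ w t → w' t ≤ -δ) : ∀ᶠ t in atTop, w t ≤ ℓ := by
  obtain ⟨T, hT⟩ := eventually_atTop.1 (hm.and (hw.and hd))
  have hcont : ∀ s t, T ≤ s → ContinuousOn w (Icc s t) := fun s t hs x hx =>
    (hT x (hs.trans hx.1)).2.1.continuousAt.continuousWithinAt
  have hstay : ∀ s t, T ≤ s → s ≤ t → w s ≤ ℓ → w t ≤ ℓ := by
    intro s t hs hst hws
    exact image_le_of_deriv_right_lt_deriv_boundary (a := s) (b := t) (B := fun _ => ℓ)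
      (B' := fun _ => 0) (hcont s t hs)
      (fun x hx => (hT x (hs.trans hx.1)).2.1.hasDerivWithinAt) hws
      (fun x => hasDerivAt_const x ℓ)
      (fun x hx hxe => by linarith [(hT x (hs.trans hx.1)).2.2 hxe.ge]) ⟨hst, le_rfl⟩
  by_cases hex : ∃ s, T ≤ s ∧ w s ≤ ℓ
  · obtain ⟨s, hs, hws⟩ := hex
    filter_upwards [eventually_ge_atTop s] with t ht using hstay s t hs ht hws
  · push Not at hex
    exfalso
    -- One unit of time after a line of slope `-δ` from `w T` has come down to the lower bound `m`.
    set t := T + ((w T - m) / δ + 1) with ht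
    have hwm : 0 ≤ (w T - m) / δ := div_nonneg (by linarith [(hT T le_rfl).1]) hδ.le
    have hTt : T ≤ t := by linarith
    have hB : ∀ x, HasDerivAt (fun x => w T - δ * (x - T)) (-δ) x := by
      intro x
      simpa using (((hasDerivAt_id x).sub_const T).const_mul δ).const_sub (w T)
    have := image_le_of_deriv_right_le_deriv_boundary (a := T) (b := t)
      (B := fun x => w T - δ * (x - T)) (B' := fun _ => -δ) (hcont T t le_rfl)
      (fun x hx => (hT x hx.1).2.1.hasDerivWithinAt) (by simp)
      (fun x _ => (hB x).continuousAt.continuousWithinAt)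
      (fun x _ => (hB x).hasDerivWithinAt)
      (fun x hx => (hT x hx.1).2.2 (hex x hx.1).le) ⟨hTt, le_rfl⟩
    have h2 : δ * (t - T) = w T - m + δ := by rw [ht]; field_simp; ring
    simp only [h2] at this
    linarith [(hT t hTt).1]

/-- Let `q` be the upper limit of `u`. Since `v` relaxes towards `u`, it is eventually below `q + ε`
as well. If `q > L`, then near `q` the cubic is at most `-γ/2` while `v - u ≤ 2ε ≤ γ/4`; hence `u`
is pushed below `q - ε`, a contradiction. -/
theorem eventually_le_of_cubic_neg {α β u v : ℝ → ℝ} {α₁ β₁ L k m : ℝ}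
    (hα : Tendsto α atTop (𝓝 α₁)) (hβ : Tendsto β atTop (𝓝 β₁))
    (hsol : ∀ᶠ t in atTop, SolvesAt α β u v t) (huk : ∀ᶠ t in atTop, u t ≤ k)
    (hum : ∀ᶠ t in atTop, m ≤ u t) (hvm : ∀ᶠ t in atTop, m ≤ v t)
    (hneg : ∀ x, L < x → x ≤ k → cubic α₁ β₁ x < 0) {ℓ : ℝ} (hℓ : L < ℓ) :
    ∀ᶠ t in atTop, u t ≤ ℓ ∧ v t ≤ ℓ := by
  set S : Set ℝ := {x | ∀ᶠ t in atTop, u t ≤ x} with hS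
  have hne : S.Nonempty := ⟨k, huk⟩
  have hbdd : BddBelow S := ⟨m, fun x hx => by
    obtain ⟨t, h1, h2⟩ := (Eventually.and hx hum).exists
    exact h2.trans h1⟩
  set q := sInf S with hq
  have hqk : q ≤ k := csInf_le hbdd huk
  have huq : ∀ ε > 0, ∀ᶠ t in atTop, u t ≤ q + ε := by
    intro ε hε
    obtain ⟨x, hx, hxq⟩ := exists_lt_of_csInf_lt hne (show sInf S < q + ε by linarith)
    filter_upwards [hx] with t ht using ht.trans hxq.le
  have hvq : ∀ ε > 0, ∀ᶠ t in atTop, v t ≤ q + ε := by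
    intro ε hε
    refine eventually_le_of_deriv_le_neg (half_pos hε) hvm (hsol.mono fun t h => h.2) ?_
    filter_upwards [huq (ε / 2) (half_pos hε)] with t ht hvt
    linarith
  have hqL : q ≤ L := by
    by_contra! hlt
    have hc : cubic α₁ β₁ q < 0 := hneg q hlt hqk
    set γ := -cubic α₁ β₁ q with hγ
    have hcont : Tendsto (fun x : ℝ × ℝ × ℝ => cubic x.1 x.2.1 x.2.2) (𝓝 (α₁, β₁, q))
        (𝓝 (cubic α₁ β₁ q)) := by
      refine Continuous.tendsto (f := fun x : ℝ × ℝ × ℝ => cubic x.1 x.2.1 x.2.2) ?_ _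
      unfold cubic
      fun_prop
    have hev := hcont.eventually_lt_const (show cubic α₁ β₁ q < -(γ / 2) by linarith)
    rw [nhds_prod_eq, nhds_prod_eq] at hev
    obtain ⟨pa, hpa, pb, hpb, hp⟩ := eventually_prod_iff.1 hev
    obtain ⟨pc, hpc, pd, hpd, hp'⟩ := eventually_prod_iff.1 hpb
    obtain ⟨ρ, hρ, hball⟩ := Metric.eventually_nhds_iff.1 hpd
    set ε := min (ρ / 2) (γ / 8) with hε
    have hε0 : 0 < ε := lt_min (half_pos hρ) (by linarith)
    have h1 : ∀ᶠ t in atTop, u t ≤ q - ε := by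
      refine eventually_le_of_deriv_le_neg (δ := γ / 4) (by linarith) hum
        (hsol.mono fun t h => h.1) ?_
      filter_upwards [huq ε hε0, hvq ε hε0, hα.eventually hpa, hβ.eventually hpc]
        with t h1 h2 h3 h4 h5
      have hu : dist (u t) q < ρ := by
        rw [Real.dist_eq, abs_lt]
        have := min_le_left (ρ / 2) (γ / 8)
        constructor <;> linarith
      have := hp h3 (hp' h4 (hball hu))
      simp only at this
      have h6 := min_le_right (ρ / 2) (γ / 8)
      linarith
    have := csInf_le hbdd h1
    linarith
  have hε : 0 < ℓ - q := by linarith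
  filter_upwards [huq _ hε, hvq _ hε] with t h1 h2
  exact ⟨by linarith, by linarith⟩

/-! ### The pullback attractor -/

/-- Near a stable equilibrium of the past limit system the equation is uniformly contracting. -/
theorem exists_cubicSlope_le {α β : ℝ → ℝ} {α₀ β₀ p : ℝ} (hα : Tendsto α atBot (𝓝 α₀))
    (hβ : Tendsto β atBot (𝓝 β₀)) (hp : cubicSlope α₀ β₀ p p < -1) :
    ∃ κ > 0, κ ≤ 1 / 4 ∧ ∃ ρ > 0, ∃ T, ∀ t ≤ T, ∀ x y, |x - p| ≤ ρ → |y - p| ≤ ρ →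
      cubicSlope (α t) (β t) x y ≤ -1 - 4 * κ := by
  set κ := min ((-1 - cubicSlope α₀ β₀ p p) / 8) (1 / 4) with hκ
  have hκ0 : 0 < κ := lt_min (by linarith) (by norm_num)
  have hκ1 : κ ≤ (-1 - cubicSlope α₀ β₀ p p) / 8 := min_le_left _ _
  have hcont : Tendsto (fun x : (ℝ × ℝ) × (ℝ × ℝ) => cubicSlope x.1.1 x.1.2 x.2.1 x.2.2)
      (𝓝 ((α₀, β₀), (p, p))) (𝓝 (cubicSlope α₀ β₀ p p)) := by
    refine Continuous.tendsto
      (f := fun x : (ℝ × ℝ) × (ℝ × ℝ) => cubicSlope x.1.1 x.1.2 x.2.1 x.2.2) ?_ _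
    unfold cubicSlope
    fun_prop
  have hev := hcont.eventually_lt_const (show cubicSlope α₀ β₀ p p < -1 - 4 * κ by linarith)
  rw [nhds_prod_eq] at hev
  obtain ⟨P, hP, Q, hQ, hPQ⟩ := eventually_prod_iff.1 hev
  obtain ⟨ρ, hρ, hball⟩ := Metric.eventually_nhds_iff.1 hQ
  obtain ⟨T, hT⟩ := eventually_atBot.1 ((hα.prodMk_nhds hβ).eventually hP)
  refine ⟨κ, hκ0, min_le_right _ _, ρ / 2, half_pos hρ, T, fun t ht x y hx hy => ?_⟩
  refine (hPQ (hT t ht) (hball (y := (x, y)) ?_)).le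
  rw [Prod.dist_eq, Real.dist_eq, Real.dist_eq]
  exact max_lt (by linarith) (by linarith)

/-- The form has matrix with rows `(q, 1)` and `(1, -1)`, negative definite exactly for `q < -1`;
the margin `4κ` below this threshold pays for the decay rate `κ`. -/
theorem quadratic_le_of_slope_le {κ q d e : ℝ} (h0 : 0 < κ) (h1 : κ ≤ 1 / 4)
    (hq : q ≤ -1 - 4 * κ) : q * d ^ 2 + 2 * d * e - e ^ 2 ≤ -κ * (d ^ 2 + e ^ 2) := by
  have h2 : q * d ^ 2 ≤ (-1 - 4 * κ) * d ^ 2 := mul_le_mul_of_nonneg_right hq (sq_nonneg d)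
  nlinarith [sq_nonneg (d - e), sq_nonneg (2 * d - e), mul_nonneg h0.le (sq_nonneg (2 * d - e)),
    mul_nonneg (by linarith : 0 ≤ 1 / 4 - κ) (sq_nonneg (d - e))]

/-- Small balls around the equilibrium are forward invariant in the far past. -/
theorem exists_forall_sq_dist_le {α β : ℝ → ℝ} {α₀ β₀ p κ ρ T : ℝ} (hα : Tendsto α atBot (𝓝 α₀))
    (hβ : Tendsto β atBot (𝓝 β₀)) (hp : cubic α₀ β₀ p = 0) (hκ : 0 < κ) (hκ1 : κ ≤ 1 / 4)
    (hρ : 0 < ρ) (hslope : ∀ t ≤ T, ∀ x y, |x - p| ≤ ρ → |y - p| ≤ ρ →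
      cubicSlope (α t) (β t) x y ≤ -1 - 4 * κ) :
    ∃ T' ≤ T, ∀ (u v : ℝ → ℝ) (t₀ : ℝ), (∀ t, t₀ ≤ t → SolvesAt α β u v t) →
      (u t₀ - p) ^ 2 + (v t₀ - p) ^ 2 ≤ ρ ^ 2 →
      ∀ t, t₀ ≤ t → t ≤ T' → (u t - p) ^ 2 + (v t - p) ^ 2 ≤ ρ ^ 2 := by
  have hlim : Tendsto (fun t => cubic (α t) (β t) p) atBot (𝓝 0) := by
    rw [← hp]
    unfold cubic
    exact (((tendsto_const_nhds.sub hα).neg).mul (tendsto_const_nhds.sub (hβ.add_const 1)))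
  obtain ⟨T₁, hT₁⟩ := eventually_atBot.1
    ((hlim.abs).eventually_lt_const (show |(0 : ℝ)| < κ * ρ by rw [abs_zero]; positivity))
  refine ⟨min T T₁, min_le_left _ _, fun u v t₀ hsol h0 t ht htT => ?_⟩
  have hder : ∀ s, t₀ ≤ s → HasDerivAt (fun s => (u s - p) ^ 2 + (v s - p) ^ 2)
      (2 * (cubicSlope (α s) (β s) (u s) p * (u s - p) ^ 2 + 2 * (u s - p) * (v s - p)
        - (v s - p) ^ 2 + cubic (α s) (β s) p * (u s - p))) s := by
    intro s hs
    obtain ⟨h1, h2⟩ := hsol s hs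
    refine (((h1.sub_const p).pow 2).add ((h2.sub_const p).pow 2)).congr_deriv ?_
    simp only [cubic, cubicSlope]
    norm_num
    ring
  refine image_le_of_deriv_right_lt_deriv_boundary (a := t₀) (b := t) (B := fun _ => ρ ^ 2)
    (B' := fun _ => 0) (fun s hs => (hder s hs.1).continuousAt.continuousWithinAt)
    (fun s hs => (hder s hs.1).hasDerivWithinAt) h0 (fun s => hasDerivAt_const s _)
    (fun s hs hse => ?_) ⟨ht, le_rfl⟩
  have hsT : s ≤ min T T₁ := hs.2.le.trans htT
  have hus : |u s - p| ≤ ρ := abs_le_of_sq_le_sq (by nlinarith [sq_nonneg (v s - p)]) hρ.le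
  have hq := quadratic_le_of_slope_le (d := u s - p) (e := v s - p) hκ hκ1
    (hslope s (hsT.trans (min_le_left _ _)) (u s) p hus (by simpa using hρ.le))
  -- `p` is not an equilibrium at time `s`, but on the circle of radius `ρ` its residual drift is
  -- weaker than the contraction `κ * ρ ^ 2`.
  have hc : |cubic (α s) (β s) p * (u s - p)| < κ * ρ * ρ := by
    rw [abs_mul]
    exact mul_lt_mul_of_nonneg_of_pos (hT₁ s (hsT.trans (min_le_right _ _))) hus
      (abs_nonneg _) hρ
  have hc' := (abs_lt.1 hc).2
  rw [hse] at hq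
  nlinarith

theorem sq_dist_le_of_contracting {α β u v w z : ℝ → ℝ} {p κ ρ T t₀ t₁ : ℝ} (hκ : 0 < κ)
    (hκ1 : κ ≤ 1 / 4) (hslope : ∀ t ≤ T, ∀ x y, |x - p| ≤ ρ → |y - p| ≤ ρ →
      cubicSlope (α t) (β t) x y ≤ -1 - 4 * κ) (h01 : t₀ ≤ t₁) (h1T : t₁ ≤ T)
    (h : ∀ t, t₀ ≤ t → t ≤ t₁ → SolvesAt α β u v t ∧ |u t - p| ≤ ρ)
    (h' : ∀ t, t₀ ≤ t → t ≤ t₁ → SolvesAt α β w z t ∧ |w t - p| ≤ ρ) :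
    (u t₁ - w t₁) ^ 2 + (v t₁ - z t₁) ^ 2 ≤
      Real.exp (-(2 * κ) * (t₁ - t₀)) * ((u t₀ - w t₀) ^ 2 + (v t₀ - z t₀) ^ 2) := by
  refine le_exp_mul_of_deriv_le (D := fun s => (u s - w s) ^ 2 + (v s - z s) ^ 2) h01
    (fun t h0 h1 => hasDerivAt_sq_dist (h t h0 h1).1 (h' t h0 h1).1) fun t h0 h1 => ?_
  have := quadratic_le_of_slope_le (d := u t - w t) (e := v t - z t) hκ hκ1
    (hslope t (h1.trans h1T) _ _ (h t h0 h1).2 (h' t h0 h1).2)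
  linarith

/-- In the far past the distance of the two solutions does not increase, and it tends to zero at
`-∞`; so it vanishes there, and by the Grönwall bound at all later times. -/
theorem eq_of_solvesAt_of_tendsto_atBot {α β u v w z : ℝ → ℝ} {A B α₀ β₀ p : ℝ}
    (hαb : ∀ t, |α t| ≤ A) (hβb : ∀ t, |β t| ≤ B) (hα : Tendsto α atBot (𝓝 α₀))
    (hβ : Tendsto β atBot (𝓝 β₀)) (hp : cubicSlope α₀ β₀ p p < -1)
    (h : ∀ t, SolvesAt α β u v t) (h' : ∀ t, SolvesAt α β w z t)
    (hu : Tendsto u atBot (𝓝 p)) (hv : Tendsto v atBot (𝓝 p))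
    (hw : Tendsto w atBot (𝓝 p)) (hz : Tendsto z atBot (𝓝 p)) : u = w ∧ v = z := by
  obtain ⟨κ, hκ, hκ1, ρ, hρ, T, hslope⟩ := exists_cubicSlope_le hα hβ hp
  have near : ∀ {f : ℝ → ℝ}, Tendsto f atBot (𝓝 p) → ∀ᶠ t in atBot, |f t - p| ≤ ρ := by
    intro f hf
    filter_upwards [hf.eventually (Metric.closedBall_mem_nhds p hρ)] with t ht
    rwa [Real.dist_eq] at ht
  obtain ⟨T₁, hT₁⟩ := eventually_atBot.1 ((near hu).and (near hw))
  have hD : Tendsto (fun s => (u s - w s) ^ 2 + (v s - z s) ^ 2) atBot (𝓝 0) := by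
    simpa using ((hu.sub hw).pow 2).add ((hv.sub hz).pow 2)
  have hzero : ∀ t ≤ min T T₁, (u t - w t) ^ 2 + (v t - z t) ^ 2 ≤ 0 := by
    intro t ht
    refine ge_of_tendsto hD ?_
    filter_upwards [eventually_le_atBot t] with s hs
    refine (sq_dist_le_of_contracting hκ hκ1 hslope hs (ht.trans (min_le_left _ _))
      (fun x _ hx => ⟨h x, (hT₁ x (hx.trans (ht.trans (min_le_right _ _)))).1⟩)
      (fun x _ hx => ⟨h' x, (hT₁ x (hx.trans (ht.trans (min_le_right _ _)))).2⟩)).trans ?_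
    refine mul_le_of_le_one_left (by positivity) (Real.exp_le_one_iff.2 ?_)
    nlinarith
  have hall : ∀ t, (u t - w t) ^ 2 + (v t - z t) ^ 2 ≤ 0 := by
    intro t
    rcases le_total t (min T T₁) with ht | ht
    · exact hzero t ht
    · refine (sq_dist_le_exp_mul hαb hβb ht (fun s _ _ => h s) (fun s _ _ => h' s)).trans ?_
      exact mul_nonpos_of_nonneg_of_nonpos (Real.exp_nonneg _) (hzero _ le_rfl)
  constructor <;> funext t <;>
    exact sub_eq_zero.1 (pow_eq_zero_iff two_ne_zero |>.1
      (by linarith [hall t, sq_nonneg (u t - w t), sq_nonneg (v t - z t)]))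

/-- The pullback construction: start at `(p, p)` at time `T - n` and let `n → ∞`. At time `T - n`
every later approximation is within `ρ` of the `n`-th, and contraction until `T` makes the
difference exponentially small in `n`. -/
theorem exists_solvesAt_tendsto_atBot {α β : ℝ → ℝ} {A B α₀ β₀ p : ℝ}
    (hαc : Continuous α) (hβc : Continuous β)
    (hαb : ∀ t, |α t| ≤ A) (hβb : ∀ t, |β t| ≤ B) (hα : Tendsto α atBot (𝓝 α₀))
    (hβ : Tendsto β atBot (𝓝 β₀)) (hp0 : cubic α₀ β₀ p = 0) (hp : cubicSlope α₀ β₀ p p < -1) :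
    ∃ u v : ℝ → ℝ, (∀ t, SolvesAt α β u v t) ∧ Tendsto u atBot (𝓝 p) ∧
      Tendsto v atBot (𝓝 p) := by
  obtain ⟨κ, hκ, hκ1, ρ, hρ, T₀, hslope⟩ := exists_cubicSlope_le hα hβ hp
  obtain ⟨T, hTT₀, hT⟩ := exists_forall_sq_dist_le hα hβ hp0 hκ hκ1 hρ hslope
  have hex := fun n : ℕ => exists_forall_ge_solvesAt hαc hβc hαb hβb (T - n) p p
  choose u v hu0 hv0 hsol using hex
  have hin : ∀ (n : ℕ) t, T - n ≤ t → t ≤ T → (u n t - p) ^ 2 + (v n t - p) ^ 2 ≤ ρ ^ 2 :=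
    fun n => hT (u n) (v n) _ (hsol n) (by rw [hu0, hv0]; simp; positivity)
  have hinu : ∀ (n : ℕ) t, T - n ≤ t → t ≤ T → |u n t - p| ≤ ρ := fun n t h1 h2 =>
    abs_le_of_sq_le_sq (by nlinarith [sq_nonneg (v n t - p), hin n t h1 h2]) hρ.le
  set C := 2 * (A ^ 2 + B + 1) with hC
  -- the approximations form a Cauchy sequence at every time
  have hpast : ∀ (n m : ℕ) t, n ≤ m → T - n ≤ t → t ≤ T →
      (u m t - u n t) ^ 2 + (v m t - v n t) ^ 2 ≤
        Real.exp (-(2 * κ) * (t - (T - n))) * ρ ^ 2 := by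
    intro n m t hnm h1 h2
    have hnm' : (n : ℝ) ≤ m := by exact_mod_cast hnm
    refine (sq_dist_le_of_contracting hκ hκ1 hslope h1 (h2.trans hTT₀)
      (fun x hx hx' => ⟨hsol m x (by linarith), hinu m x (by linarith) (by linarith)⟩)
      (fun x hx hx' => ⟨hsol n x hx, hinu n x hx (by linarith)⟩)).trans ?_
    refine mul_le_mul_of_nonneg_left ?_ (Real.exp_nonneg _)
    rw [hu0, hv0]
    exact hin m _ (by linarith) (by linarith [n.cast_nonneg (α := ℝ)])
  -- Beyond `T` distances may grow, but by a factor that depends on `t` alone and not on `n`.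
  have hest : ∀ t, ∃ R : ℝ, ∀ n m : ℕ, n ≤ m → T - n ≤ t →
      (u m t - u n t) ^ 2 + (v m t - v n t) ^ 2 ≤ R * Real.exp (-(2 * κ) * n) := by
    intro t
    rcases le_total t T with ht | ht
    · refine ⟨Real.exp (-(2 * κ) * (t - T)) * ρ ^ 2, fun n m hnm hn => ?_⟩
      refine (hpast n m t hnm hn ht).trans_eq ?_
      rw [show -(2 * κ) * (t - (T - n)) = -(2 * κ) * (t - T) + -(2 * κ) * n by ring, Real.exp_add]
      ring
    · refine ⟨Real.exp (C * (t - T)) * ρ ^ 2, fun n m hnm hn => ?_⟩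
      have hnm' : (n : ℝ) ≤ m := by exact_mod_cast hnm
      have hn0 : (0 : ℝ) ≤ n := n.cast_nonneg
      refine (sq_dist_le_exp_mul hαb hβb ht (fun s hs _ => hsol m s (by linarith))
        (fun s hs _ => hsol n s (by linarith))).trans ?_
      rw [mul_assoc (Real.exp _) (ρ ^ 2)]
      refine mul_le_mul_of_nonneg_left ?_ (Real.exp_nonneg _)
      refine (hpast n m T hnm (by linarith) le_rfl).trans_eq ?_
      rw [show T - (T - n) = (n : ℝ) by ring]
      ring
  have hsmall : ∀ t, ∀ ε > 0, ∃ N : ℕ, ∀ n ≥ N,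
      (u n t - u N t) ^ 2 + (v n t - v N t) ^ 2 < ε ^ 2 := by
    intro t ε hε
    obtain ⟨R, hR⟩ := hest t
    have hlim : Tendsto (fun n : ℕ => R * Real.exp (-(2 * κ) * n)) atTop (𝓝 0) := by
      have h1 : Tendsto (fun n : ℕ => -(2 * κ) * (n : ℝ)) atTop atBot :=
        tendsto_natCast_atTop_atTop.const_mul_atTop_of_neg (by linarith)
      simpa using (Real.tendsto_exp_atBot.comp h1).const_mul R
    obtain ⟨N, hN1, hN2⟩ := ((hlim.eventually_lt_const (show 0 < ε ^ 2 by positivity)).and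
      (tendsto_natCast_atTop_atTop.eventually_ge_atTop (T - t))).exists
    exact ⟨N, fun n hn => (hR N n hn (by linarith)).trans_lt hN1⟩
  have hconv : ∀ t, ∃ x : ℝ × ℝ, Tendsto (fun n => u n t) atTop (𝓝 x.1) ∧
      Tendsto (fun n => v n t) atTop (𝓝 x.2) := by
    intro t
    have hcu : CauchySeq fun n => u n t := Metric.cauchySeq_iff'.2 fun ε hε => by
      obtain ⟨N, hN⟩ := hsmall t ε hε
      exact ⟨N, fun n hn => abs_lt_of_sq_lt_sq
        (by nlinarith [hN n hn, sq_nonneg (v n t - v N t)]) hε.le⟩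
    have hcv : CauchySeq fun n => v n t := Metric.cauchySeq_iff'.2 fun ε hε => by
      obtain ⟨N, hN⟩ := hsmall t ε hε
      exact ⟨N, fun n hn => abs_lt_of_sq_lt_sq
        (by nlinarith [hN n hn, sq_nonneg (u n t - u N t)]) hε.le⟩
    obtain ⟨x, hx⟩ := cauchySeq_tendsto_of_complete hcu
    obtain ⟨y, hy⟩ := cauchySeq_tendsto_of_complete hcv
    exact ⟨(x, y), hx, hy⟩
  choose X hXu hXv using hconv
  have hlimD : ∀ (t x y : ℝ), Tendsto (fun n => (u n t - x) ^ 2 + (v n t - y) ^ 2) atTop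
      (𝓝 (((X t).1 - x) ^ 2 + ((X t).2 - y) ^ 2)) := fun t x y =>
    (((hXu t).sub_const x).pow 2).add (((hXv t).sub_const y).pow 2)
  have hstart : ∀ s : ℝ, ∀ᶠ n : ℕ in atTop, T - n ≤ s := fun s => by
    filter_upwards [tendsto_natCast_atTop_atTop.eventually_ge_atTop (T - s)] with n hn
    linarith
  refine ⟨fun t => (X t).1, fun t => (X t).2, fun t => ?_, ?_⟩
  · -- the limit agrees with the solution that starts on it
    obtain ⟨w, z, hw0, hz0, hwz⟩ :=
      exists_forall_ge_solvesAt hαc hβc hαb hβb (t - 1) (X (t - 1)).1 (X (t - 1)).2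
    have heq : ∀ s, t - 1 ≤ s → (X s).1 = w s ∧ (X s).2 = z s := by
      intro s hs
      have h1 : Tendsto (fun n => Real.exp (C * (s - (t - 1))) *
          ((u n (t - 1) - w (t - 1)) ^ 2 + (v n (t - 1) - z (t - 1)) ^ 2)) atTop (𝓝 0) := by
        have := (hlimD (t - 1) (w (t - 1)) (z (t - 1))).const_mul
          (Real.exp (C * (s - (t - 1))))
        simpa [hw0, hz0] using this
      have h2 : ((X s).1 - w s) ^ 2 + ((X s).2 - z s) ^ 2 ≤ 0 := by
        refine le_of_tendsto_of_tendsto (hlimD s (w s) (z s)) h1 ?_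
        filter_upwards [hstart (t - 1)] with n hn
        exact sq_dist_le_exp_mul hαb hβb hs (fun x hx _ => hsol n x (hn.trans hx))
          (fun x hx _ => hwz x hx)
      have h3 := sq_nonneg ((X s).1 - w s)
      have h4 := sq_nonneg ((X s).2 - z s)
      exact ⟨sub_eq_zero.1 (pow_eq_zero_iff two_ne_zero |>.1 (by linarith)),
        sub_eq_zero.1 (pow_eq_zero_iff two_ne_zero |>.1 (by linarith))⟩
    have hnear : ∀ᶠ s in 𝓝 t, t - 1 ≤ s := Ici_mem_nhds (by linarith)
    obtain ⟨hd1, hd2⟩ := hwz t (by linarith)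
    obtain ⟨e1, e2⟩ := heq t (by linarith)
    refine ⟨?_, ?_⟩
    · simp only [e1, e2]
      exact hd1.congr_of_eventuallyEq (hnear.mono fun s hs => (heq s hs).1)
    · simp only [e1, e2]
      exact hd2.congr_of_eventuallyEq (hnear.mono fun s hs => (heq s hs).2)
  -- Any smaller ball is trapping before some `T'` that is the same for all approximations, so their
  -- limit inherits the bound.
  · have hclose : ∀ ε > 0, ∀ᶠ t in atBot, ((X t).1 - p) ^ 2 + ((X t).2 - p) ^ 2 ≤ ε ^ 2 := by
      intro ε hε
      set ρ' := min ε ρ with hρ'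
      have hρ'0 : 0 < ρ' := lt_min hε hρ
      obtain ⟨T', -, hT'⟩ := exists_forall_sq_dist_le hα hβ hp0 hκ hκ1 hρ'0
        (fun t ht x y hx hy => hslope t ht x y (hx.trans (min_le_right _ _))
          (hy.trans (min_le_right _ _)))
      filter_upwards [eventually_le_atBot T'] with t ht
      refine le_of_tendsto (hlimD t p p) ?_
      filter_upwards [hstart t] with n hn
      refine (hT' (u n) (v n) _ (hsol n) (by rw [hu0, hv0]; simp; positivity) t hn ht).trans ?_
      exact pow_le_pow_left₀ hρ'0.le (min_le_left _ _) 2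
    constructor
    · refine Metric.tendsto_nhds.2 fun ε hε => ?_
      filter_upwards [hclose (ε / 2) (half_pos hε)] with t ht
      rw [Real.dist_eq]
      exact abs_lt_of_sq_lt_sq (by nlinarith [sq_nonneg ((X t).2 - p)]) hε.le
    · refine Metric.tendsto_nhds.2 fun ε hε => ?_
      filter_upwards [hclose (ε / 2) (half_pos hε)] with t ht
      rw [Real.dist_eq]
      exact abs_lt_of_sq_lt_sq (by nlinarith [sq_nonneg ((X t).1 - p)]) hε.le

/-! ### From the plane to coordinates -/

theorem hasDerivAt_fin_two_iff {x : ℝ → EuclideanSpace ℝ (Fin 2)} {p q t : ℝ} :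
    HasDerivAt x !₂[p, q] t ↔
      HasDerivAt (fun s => x s 0) p t ∧ HasDerivAt (fun s => x s 1) q t := by
  rw [← hasDerivWithinAt_univ, hasDerivWithinAt_iff_hasFDerivWithinAt,
    hasFDerivWithinAt_euclidean, Fin.forall_fin_two]
  simp only [← hasDerivWithinAt_univ (𝕜 := ℝ) (F := ℝ), hasDerivWithinAt_iff_hasFDerivWithinAt]
  refine and_congr (iff_of_eq ?_) (iff_of_eq ?_) <;> congr 1

theorem tendsto_fin_two_iff {ι : Type*} {l : Filter ι} {x : ι → EuclideanSpace ℝ (Fin 2)}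
    {p q : ℝ} : Tendsto x l (𝓝 !₂[p, q]) ↔
      Tendsto (fun s => x s 0) l (𝓝 p) ∧ Tendsto (fun s => x s 1) l (𝓝 q) := by
  rw [(PiLp.homeomorph 2 (fun _ : Fin 2 => ℝ)).isInducing.tendsto_nhds_iff, tendsto_pi_nhds,
    Fin.forall_fin_two]
  rfl

theorem hasDerivAt_F_iff {a b lam : ℝ → ℝ} {x : ℝ → EuclideanSpace ℝ (Fin 2)} {t : ℝ} :
    HasDerivAt x (F a b (x t) (lam t)) t ↔
      SolvesAt (fun s => a (lam s)) (fun s => b (lam s)) (fun s => x s 0) (fun s => x s 1) t := by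
  unfold F SolvesAt
  rw [hasDerivAt_fin_two_iff]
  refine and_congr (iff_of_eq ?_) Iff.rfl
  congr 1
  unfold cubic
  ring

/-! ### Attracting equilibria -/

/-- A nonreal root has real part `τ / 2`; at a real `μ ≥ 0` the polynomial is at least `d > 0`. -/
theorem re_neg_of_quadratic {τ d : ℝ} (hτ : τ < 0) (hd : 0 < d) {μ : ℂ}
    (h : μ ^ 2 - τ * μ + d = 0) : μ.re < 0 := by
  have h1 := congrArg Complex.re h
  have h2 := congrArg Complex.im h
  simp [pow_two] at h1 h2
  by_contra! hre
  rcases eq_or_ne μ.im 0 with him | him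
  · rw [him] at h1
    nlinarith
  · have : μ.im * (2 * μ.re - τ) = 0 := by linarith
    rcases mul_eq_zero.1 this with h3 | h3
    · exact him h3
    · linarith

/-- The Jacobian has rows `(σ, 1)` and `(1, -1)` with `σ = cubicSlope q q`; its trace `σ - 1` is
negative and its determinant `-σ - 1` positive when `σ < -1`. -/
theorem isAttractingEquilibrium_F {a b : ℝ → ℝ} {l q : ℝ} (h0 : cubic (a l) (b l) q = 0)
    (h1 : cubicSlope (a l) (b l) q q < -1) : IsAttractingEquilibrium (F a b) l !₂[q, q] := by
  refine ⟨?_, Matrix.toEuclideanCLM (n := Fin 2) (𝕜 := ℝ)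
    !![cubicSlope (a l) (b l) q q, 1; 1, -1], ?_, ?_⟩
  · unfold cubic at h0
    ext i
    fin_cases i
    · simp [F]; linarith
    · simp [F]
  · rw [← hasFDerivWithinAt_univ, hasFDerivWithinAt_euclidean, Fin.forall_fin_two]
    simp only [hasFDerivWithinAt_univ]
    have hx : ∀ i : Fin 2, HasFDerivAt (fun y : EuclideanSpace ℝ (Fin 2) => y i)
        (EuclideanSpace.proj i : EuclideanSpace ℝ (Fin 2) →L[ℝ] ℝ) !₂[q, q] :=
      fun i => (EuclideanSpace.proj (𝕜 := ℝ) i).hasFDerivAt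
    constructor
    · have h := (((((hx 0).pow 3).neg.add (((hx 0).pow 2).const_mul (a l))).add
        ((hx 0).const_mul (b l))).sub_const (a l * (b l + 1))).add (hx 1)
      refine h.congr_fderiv ?_
      ext y
      simp [Matrix.mulVec, dotProduct, Fin.sum_univ_two, cubicSlope]
      ring
    · refine ((hx 0).sub (hx 1)).congr_fderiv ?_
      ext y
      simp [Matrix.mulVec, dotProduct, Fin.sum_univ_two]
      ring
  · intro μ hμ
    rw [Matrix.coe_toEuclideanCLM_eq_toEuclideanLin, Matrix.toEuclideanLin, Matrix.toLpLin_eq_toLin,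
      Matrix.charpoly_toLin, Matrix.charpoly_fin_two] at hμ
    simp only [Matrix.trace_fin_two_of, Matrix.det_fin_two_of] at hμ
    refine re_neg_of_quadratic (τ := cubicSlope (a l) (b l) q q + -1)
      (d := cubicSlope (a l) (b l) q q * -1 - 1 * 1) (by linarith) (by linarith) ?_
    simpa [Polynomial.IsRoot] using hμ

/-! ### The reflection `x ↦ -x` -/

section Reflection

variable {E : Type*} [NormedAddCommGroup E] [NormedSpace ℝ E] {f f' : E → ℝ → E}

theorem IsAttractingEquilibrium.reflect [FiniteDimensional ℝ E] (hf : ∀ x l, f' x l = -f (-x) l)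
    {l : ℝ} {x : E} (h : IsAttractingEquilibrium f l x) : IsAttractingEquilibrium f' l (-x) := by
  obtain ⟨h0, A, hA, hspec⟩ := h
  -- The two signs cancel in the linearization, so the spectrum is unchanged.
  refine ⟨by rw [hf, neg_neg, h0, neg_zero], A, ?_, hspec⟩
  have h1 : HasFDerivAt (fun y : E => -y) (-ContinuousLinearMap.id ℝ E) (-x) :=
    (hasFDerivAt_id (-x)).neg
  have h2 : HasFDerivAt (fun y => f y l) A (-(-x)) := by rwa [neg_neg]
  have h3 := (h2.comp (-x) h1).neg
  have h4 : (fun y => f' y l) = -((fun y => f y l) ∘ fun y : E => -y) := by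
    funext y; simp [hf]
  rw [h4]
  refine h3.congr_fderiv ?_
  ext y
  simp

theorem IsStablePath.reflect [FiniteDimensional ℝ E] (hf : ∀ x l, f' x l = -f (-x) l)
    {Λ : ℝ → ℝ} {lm lp : ℝ} {X : ℝ → E} {Xm Xp : E} (h : IsStablePath f Λ lm lp X Xm Xp) :
    IsStablePath f' Λ lm lp (fun s => -X s) (-Xm) (-Xp) where
  continuous := h.continuous.neg
  attracting s := (h.attracting s).reflect hf
  tendsto_atBot := h.tendsto_atBot.neg
  tendsto_atTop := h.tendsto_atTop.neg
  attracting_atBot := h.attracting_atBot.reflect hf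
  attracting_atTop := h.attracting_atTop.reflect hf

theorem EmanatesFrom.reflect (hf : ∀ x l, f' x l = -f (-x) l) {Λ : ℝ → ℝ} {r : ℝ} {Xm : E}
    {x : ℝ → E} (h : EmanatesFrom f Λ r Xm x) : EmanatesFrom f' Λ r (-Xm) (-x) := by
  refine ⟨fun t => ?_, h.2.neg⟩
  rw [hf, Pi.neg_apply, neg_neg]
  exact (h.1 t).neg

theorem IsPullbackAttractor.reflect (hf : ∀ x l, f' x l = -f (-x) l) {Λ : ℝ → ℝ} {r : ℝ} {Xm : E}
    {x : ℝ → E} (h : IsPullbackAttractor f Λ r Xm x) : IsPullbackAttractor f' Λ r (-Xm) (-x) := by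
  refine ⟨h.1.reflect hf, fun y hy => ?_⟩
  have hy' := EmanatesFrom.reflect (f' := f) (fun x l => by rw [hf, neg_neg, neg_neg]) hy
  rw [neg_neg] at hy'
  rw [← h.2 _ hy', neg_neg]

theorem RTips.reflect (hf : ∀ x l, f' x l = -f (-x) l) {Λ : ℝ → ℝ} {r : ℝ} {Xm Xp : E}
    (h : RTips f Λ r Xm Xp) : RTips f' Λ r (-Xm) (-Xp) := by
  obtain ⟨x, hx, hlim⟩ := h
  refine ⟨-x, hx.reflect hf, fun hc => hlim ?_⟩
  simpa using hc.neg

theorem RTippingPossible.reflect [FiniteDimensional ℝ E] (hf : ∀ x l, f' x l = -f (-x) l)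
    {Λ : ℝ → ℝ} {lm lp : ℝ} {X : ℝ → E} {Xm Xp : E} (h : RTippingPossible f Λ lm lp X Xm Xp) :
    RTippingPossible f' Λ lm lp (fun s => -X s) (-Xm) (-Xp) := by
  obtain ⟨h1, σ, h2, h3, r, hr, h4⟩ := h
  exact ⟨h1.reflect hf, σ, h2, h3, r, hr, h4.reflect hf⟩

theorem NoRTipping.reflect (hf : ∀ x l, f' x l = -f (-x) l) {Λ : ℝ → ℝ} {Xm Xp : E}
    (h : NoRTipping f Λ Xm Xp) : NoRTipping f' Λ (-Xm) (-Xp) := by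
  intro r hr
  obtain ⟨x, hx, hlim⟩ := h r hr
  exact ⟨-x, hx.reflect hf, hlim.neg⟩

theorem mem_basin_reflect (hf : ∀ x l, f' x l = -f (-x) l) {l : ℝ} {p x : E}
    (h : x ∈ basin f l p) : -x ∈ basin f' l (-p) := by
  obtain ⟨φ, h0, hφ, hlim⟩ := h
  refine ⟨-φ, by simp [h0], fun t ht => ?_, hlim.neg⟩
  rw [hf, Pi.neg_apply, neg_neg]
  exact (hφ t ht).neg

theorem PointsStrictlyInto.reflect {K : Set E} {x v : E} (h : PointsStrictlyInto K x v) :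
    PointsStrictlyInto (Neg.neg ⁻¹' K) (-x) (-v) := by
  obtain ⟨δ, hδ, h⟩ := h
  refine ⟨δ, hδ, fun s hs w hw => ?_⟩
  have := h s hs (-w) (by
    rwa [Metric.mem_ball, ← dist_neg_neg, neg_neg])
  simpa [add_comm] using this

theorem IsForwardInflowingStable.reflect [FiniteDimensional ℝ E]
    (hf : ∀ x l, f' x l = -f (-x) l) {Λ : ℝ → ℝ} {lm lp : ℝ} {X : ℝ → E} {Xm Xp : E}
    (h : IsForwardInflowingStable f Λ lm lp X Xm Xp) :
    IsForwardInflowingStable f' Λ lm lp (fun s => -X s) (-Xm) (-Xp) := by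
  obtain ⟨hX, K, h1, h2, h3, h4, h5, h6, h7, h8⟩ := h
  have hint : ∀ S : Set E, interior (Neg.neg ⁻¹' S) = Neg.neg ⁻¹' interior S := fun S =>
    ((Homeomorph.neg E).preimage_interior S).symm
  have hclo : closure (⋃ s, Neg.neg ⁻¹' K s) = Neg.neg ⁻¹' closure (⋃ s, K s) := by
    rw [← preimage_iUnion]
    exact ((Homeomorph.neg E).preimage_closure _).symm
  refine ⟨hX.reflect hf, fun s => Neg.neg ⁻¹' K s, fun s => ?_, fun s => ?_, fun s₁ s₂ hs => ?_,
    fun s x hx => ?_, ?_, ?_, ?_, ?_⟩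
  · exact (Homeomorph.neg E).isCompact_preimage.2 (h1 s)
  · rw [hint, mem_preimage, neg_neg]
    exact h2 s
  · exact preimage_mono (h3 s₁ s₂ hs)
  · have hx' : -x ∈ frontier (K s) := by
      rw [show frontier (Neg.neg ⁻¹' K s) = Neg.neg ⁻¹' frontier (K s) from
        ((Homeomorph.neg E).preimage_frontier _).symm] at hx
      exact hx
    have := (h4 s _ hx').reflect
    rwa [neg_neg, ← hf] at this
  · rw [← preimage_iInter, hint, mem_preimage, neg_neg]
    exact h5
  · rw [hclo, hint, mem_preimage, neg_neg]
    exact h6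
  · rw [hclo]
    exact (Homeomorph.neg E).isCompact_preimage.2 h7
  · rw [hclo]
    intro x hx
    have := mem_basin_reflect hf (h8 hx)
    rwa [neg_neg] at this

end Reflection

theorem F_reflect (a b : ℝ → ℝ) (x : EuclideanSpace ℝ (Fin 2)) (l : ℝ) :
    F a b x l = -F (-a) b (-x) l := by
  ext i
  fin_cases i
  · simp [F]; ring
  · simp [F]; ring

theorem p₃_eq_neg (b : ℝ → ℝ) (l : ℝ) : p₃ b l = -p₁ b l := by
  ext i
  fin_cases i <;> simp [p₁, p₃]

/-! ### The coefficients along a parameter shift -/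

section Coefficients

variable {Λ a b : ℝ → ℝ} {lm lp r : ℝ}

theorem IsParameterShift.mem_Icc (hΛ : IsParameterShift Λ lm lp) (s : ℝ) : Λ s ∈ Icc lm lp :=
  Ioo_subset_Icc_self (hΛ.mem_Ioo s)

theorem IsParameterShift.le (hΛ : IsParameterShift Λ lm lp) : lm ≤ lp :=
  (hΛ.mem_Icc 0).1.trans (hΛ.mem_Icc 0).2

theorem IsParameterShift.continuous_comp (hΛ : IsParameterShift Λ lm lp)
    (ha : ContinuousOn a (Icc lm lp)) : Continuous fun s => a (Λ s) :=
  ha.comp_continuous hΛ.contDiff.continuous hΛ.mem_Icc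

theorem IsParameterShift.tendsto_comp_atBot (hΛ : IsParameterShift Λ lm lp)
    (ha : ContinuousOn a (Icc lm lp)) : Tendsto (fun s => a (Λ s)) atBot (𝓝 (a lm)) :=
  (ha lm (left_mem_Icc.2 hΛ.le)).tendsto.comp
    (tendsto_nhdsWithin_iff.2 ⟨hΛ.tendsto_atBot, Eventually.of_forall hΛ.mem_Icc⟩)

theorem IsParameterShift.tendsto_comp_atTop (hΛ : IsParameterShift Λ lm lp)
    (ha : ContinuousOn a (Icc lm lp)) : Tendsto (fun s => a (Λ s)) atTop (𝓝 (a lp)) :=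
  (ha lp (right_mem_Icc.2 hΛ.le)).tendsto.comp
    (tendsto_nhdsWithin_iff.2 ⟨hΛ.tendsto_atTop, Eventually.of_forall hΛ.mem_Icc⟩)

theorem exists_abs_le_of_continuousOn_Icc (ha : ContinuousOn a (Icc lm lp)) :
    ∃ A, ∀ l ∈ Icc lm lp, |a l| ≤ A := isCompact_Icc.exists_bound_of_continuousOn ha

theorem exists_isPullbackAttractor (hΛ : IsParameterShift Λ lm lp)
    (ha : ContinuousOn a (Icc lm lp)) (hb : ContinuousOn b (Icc lm lp)) (hr : 0 < r) {q : ℝ}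
    (h0 : cubic (a lm) (b lm) q = 0) (h1 : cubicSlope (a lm) (b lm) q q < -1) :
    ∃ x, IsPullbackAttractor (F a b) Λ r !₂[q, q] x := by
  obtain ⟨A, hA⟩ := exists_abs_le_of_continuousOn_Icc ha
  obtain ⟨B, hB⟩ := exists_abs_le_of_continuousOn_Icc hb
  have hαc : Continuous fun t => a (Λ (r * t)) := (hΛ.continuous_comp ha).comp (by fun_prop)
  have hβc : Continuous fun t => b (Λ (r * t)) := (hΛ.continuous_comp hb).comp (by fun_prop)
  have hrt : Tendsto (fun t => r * t) atBot atBot := tendsto_id.const_mul_atBot hr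
  have hα : Tendsto (fun t => a (Λ (r * t))) atBot (𝓝 (a lm)) :=
    (hΛ.tendsto_comp_atBot ha).comp hrt
  have hβ : Tendsto (fun t => b (Λ (r * t))) atBot (𝓝 (b lm)) :=
    (hΛ.tendsto_comp_atBot hb).comp hrt
  have hαA : ∀ t, |a (Λ (r * t))| ≤ A := fun t => hA _ (hΛ.mem_Icc _)
  have hβB : ∀ t, |b (Λ (r * t))| ≤ B := fun t => hB _ (hΛ.mem_Icc _)
  obtain ⟨u, v, hsol, hu, hv⟩ := exists_solvesAt_tendsto_atBot hαc hβc hαA hβB hα hβ h0 h1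
  refine ⟨fun t => !₂[u t, v t], ⟨fun t => ?_, ?_⟩, fun y hy => ?_⟩
  · exact (hasDerivAt_F_iff (lam := fun t => Λ (r * t)) (x := fun t => !₂[u t, v t])).2 (hsol t)
  · exact tendsto_fin_two_iff.2 ⟨hu, hv⟩
  · obtain ⟨hy1, hy2⟩ := tendsto_fin_two_iff.1 hy.2
    obtain ⟨e1, e2⟩ := eq_of_solvesAt_of_tendsto_atBot hαA hβB hα hβ h1
      (fun t => (hasDerivAt_F_iff (lam := fun t => Λ (r * t))).1 (hy.1 t)) hsol hy1 hy2 hu hv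
    funext t
    ext i
    fin_cases i
    · exact congrFun e1 t
    · exact congrFun e2 t

theorem cubic_sqrt {α β : ℝ} (hβ : -1 < β) : cubic α β √(β + 1) = 0 := by
  unfold cubic
  rw [Real.sq_sqrt (by linarith)]
  ring

/-- At `c = √(β + 1)` the slope equals `-1 - 2 * c * (c - α)`. -/
theorem cubicSlope_sqrt_lt {α β : ℝ} (hβ : -1 < β) (h : |α| < √(β + 1)) :
    cubicSlope α β √(β + 1) √(β + 1) < -1 := by
  have h1 : √(β + 1) ^ 2 = β + 1 := Real.sq_sqrt (by linarith)
  have h2 : 0 < √(β + 1) := Real.sqrt_pos.2 (by linarith)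
  have h3 : 0 < √(β + 1) * (√(β + 1) - α) := mul_pos h2 (by linarith [(abs_lt.1 h).2])
  unfold cubicSlope
  nlinarith

theorem isStablePath_p₃ (hΛ : IsParameterShift Λ lm lp)
    (hb : ContinuousOn b (Icc lm lp)) (hb1 : ∀ l ∈ Icc lm lp, -1 < b l)
    (hab : ∀ l ∈ Icc lm lp, |a l| < √(b l + 1)) :
    IsStablePath (F a b) Λ lm lp (fun s => p₃ b (Λ s)) (p₃ b lm) (p₃ b lp) := by
  have hc : ContinuousOn (fun l => √(b l + 1)) (Icc lm lp) := (hb.add continuousOn_const).sqrt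
  have hatt : ∀ l ∈ Icc lm lp, IsAttractingEquilibrium (F a b) l (p₃ b l) := fun l hl =>
    isAttractingEquilibrium_F (cubic_sqrt (hb1 l hl)) (cubicSlope_sqrt_lt (hb1 l hl) (hab l hl))
  have hcΛ := hΛ.continuous_comp hc
  exact
    { continuous := continuous_iff_continuousAt.2 fun s =>
        tendsto_fin_two_iff.2 ⟨hcΛ.tendsto s, hcΛ.tendsto s⟩
      attracting := fun s => hatt _ (hΛ.mem_Icc s)
      tendsto_atBot :=
        tendsto_fin_two_iff.2 ⟨hΛ.tendsto_comp_atBot hc, hΛ.tendsto_comp_atBot hc⟩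
      tendsto_atTop :=
        tendsto_fin_two_iff.2 ⟨hΛ.tendsto_comp_atTop hc, hΛ.tendsto_comp_atTop hc⟩
      attracting_atBot := hatt _ (left_mem_Icc.2 hΛ.le)
      attracting_atTop := hatt _ (right_mem_Icc.2 hΛ.le) }

theorem isStablePath_p₁ (hΛ : IsParameterShift Λ lm lp)
    (hb : ContinuousOn b (Icc lm lp)) (hb1 : ∀ l ∈ Icc lm lp, -1 < b l)
    (hab : ∀ l ∈ Icc lm lp, |a l| < √(b l + 1)) :
    IsStablePath (F a b) Λ lm lp (fun s => p₁ b (Λ s)) (p₁ b lm) (p₁ b lp) := by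
  have := (isStablePath_p₃ (a := -a) hΛ hb hb1 (by simpa using hab)).reflect (F_reflect a b)
  simpa only [p₃_eq_neg, neg_neg] using this

end Coefficients

/-! ### Sign of the cubic -/

theorem cubic_eq_of_sq_eq {α β c : ℝ} (hc : c ^ 2 = β + 1) (x : ℝ) :
    cubic α β x = -((α - x) * (c - x) * (x + c)) := by
  unfold cubic
  rw [← hc]
  ring

/-- Each of the three linear factors is at least `θ`. The resulting `θ ^ 3` sets the scale of all
later margins: barriers for `v` are offset by `θ ^ 3 / 2`. -/
theorem cubic_le_neg_pow_of_between {α β c x θ : ℝ} (hc : c ^ 2 = β + 1) (hαc : α ≤ c)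
    (hθ : 0 ≤ θ) (h1 : -c + θ ≤ x) (h2 : x ≤ α - θ) : cubic α β x ≤ -θ ^ 3 := by
  rw [cubic_eq_of_sq_eq hc, show θ ^ 3 = θ * θ * θ by ring, neg_le_neg_iff]
  have h3 : θ ≤ α - x := by linarith
  have h4 : θ ≤ c - x := by linarith
  have h5 : θ ≤ x + c := by linarith
  exact mul_le_mul (mul_le_mul h3 h4 hθ (hθ.trans h3)) h5 hθ
    (mul_nonneg (hθ.trans h3) (hθ.trans h4))

theorem cubic_le_neg_pow_of_ge {α β c x θ : ℝ} (hc : c ^ 2 = β + 1) (hc0 : 0 ≤ c) (hαc : α ≤ c)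
    (hθ : 0 ≤ θ) (h1 : c + θ ≤ x) : cubic α β x ≤ -θ ^ 3 := by
  rw [cubic_eq_of_sq_eq hc, show θ ^ 3 = θ * θ * θ by ring, neg_le_neg_iff,
    show (α - x) * (c - x) = (x - α) * (x - c) by ring]
  have h3 : θ ≤ x - α := by linarith
  have h4 : θ ≤ x - c := by linarith
  have h5 : θ ≤ x + c := by linarith
  exact mul_le_mul (mul_le_mul h3 h4 hθ (hθ.trans h3)) h5 hθ
    (mul_nonneg (hθ.trans h3) (hθ.trans h4))

theorem cubic_neg_of_between {α β c x : ℝ} (hc : c ^ 2 = β + 1) (hαc : α ≤ c) (h1 : -c < x)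
    (h2 : x < α) : cubic α β x < 0 := by
  rw [cubic_eq_of_sq_eq hc]
  have := mul_pos (mul_pos (sub_pos.2 h2) (sub_pos.2 (h2.trans_le hαc)))
    (show 0 < x + c by linarith)
  linarith

theorem cubic_neg_of_gt {α β c x : ℝ} (hc : c ^ 2 = β + 1) (hc0 : 0 ≤ c) (hαc : α ≤ c)
    (h1 : c < x) : cubic α β x < 0 := by
  rw [cubic_eq_of_sq_eq hc]
  have := mul_pos (mul_pos (sub_pos.2 (hαc.trans_lt h1)) (sub_pos.2 h1))
    (show 0 < x + c by linarith)
  linarith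

/-- Solutions that stay below the saddle converge to the lower equilibrium. -/
theorem tendsto_neg_of_lt_saddle {α β u v : ℝ → ℝ} {α₁ β₁ c k M : ℝ} (hc : c ^ 2 = β₁ + 1)
    (hc0 : 0 ≤ c) (hαc : |α₁| ≤ c) (hα : Tendsto α atTop (𝓝 α₁)) (hβ : Tendsto β atTop (𝓝 β₁))
    (hsol : ∀ᶠ t in atTop, SolvesAt α β u v t) (huk : ∀ᶠ t in atTop, u t ≤ k) (hk : k < α₁)
    (hu : ∀ᶠ t in atTop, |u t| ≤ M) (hv : ∀ᶠ t in atTop, |v t| ≤ M) :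
    Tendsto u atTop (𝓝 (-c)) ∧ Tendsto v atTop (𝓝 (-c)) := by
  rw [abs_le] at hαc
  have hupper : ∀ ℓ, -c < ℓ → ∀ᶠ t in atTop, u t ≤ ℓ ∧ v t ≤ ℓ := fun ℓ hℓ =>
    eventually_le_of_cubic_neg hα hβ hsol huk (hu.mono fun t h => (abs_le.1 h).1)
      (hv.mono fun t h => (abs_le.1 h).1)
      (fun x h1 h2 => cubic_neg_of_between hc hαc.2 h1 (h2.trans_lt hk)) hℓ
  -- For the reflected solution the cubic is negative everywhere above `c`, so the a priori bound
  -- `M` serves as the initial upper bound.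
  have hlower : ∀ ℓ, c < ℓ → ∀ᶠ t in atTop, -u t ≤ ℓ ∧ -v t ≤ ℓ := fun ℓ hℓ =>
    eventually_le_of_cubic_neg (u := -u) (v := -v) hα.neg hβ (hsol.mono fun t h => h.neg)
      (k := M) (m := -M)
      (hu.mono fun t h => by have := abs_le.1 h; simp only [Pi.neg_apply]; linarith)
      (hu.mono fun t h => by have := abs_le.1 h; simp only [Pi.neg_apply]; linarith)
      (hv.mono fun t h => by have := abs_le.1 h; simp only [Pi.neg_apply]; linarith)
      (fun x h1 _ => cubic_neg_of_gt hc hc0 (by linarith) h1) hℓ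
  constructor <;> refine tendsto_order.2 ⟨fun y hy => ?_, fun y hy => ?_⟩
  · filter_upwards [hlower ((c - y) / 2) (by linarith)] with t ht
    linarith [ht.1]
  · filter_upwards [hupper ((-c + y) / 2) (by linarith)] with t ht
    linarith [ht.1]
  · filter_upwards [hlower ((c - y) / 2) (by linarith)] with t ht
    linarith [ht.2]
  · filter_upwards [hupper ((-c + y) / 2) (by linarith)] with t ht
    linarith [ht.2]

/-! ### Boxes -/

/-- The closed box `[p, q] × [p', q']`. -/
def box (p q p' q' : ℝ) : Set (EuclideanSpace ℝ (Fin 2)) :=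
  {x | (p ≤ x 0 ∧ x 0 ≤ q) ∧ (p' ≤ x 1 ∧ x 1 ≤ q')}

theorem isClosed_box (p q p' q' : ℝ) : IsClosed (box p q p' q') := by
  have h0 : Continuous fun x : EuclideanSpace ℝ (Fin 2) => x 0 := by fun_prop
  have h1 : Continuous fun x : EuclideanSpace ℝ (Fin 2) => x 1 := by fun_prop
  exact ((isClosed_le continuous_const h0).inter (isClosed_le h0 continuous_const)).inter
    ((isClosed_le continuous_const h1).inter (isClosed_le h1 continuous_const))

theorem isCompact_box (p q p' q' : ℝ) : IsCompact (box p q p' q') := by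
  have h : box p q p' q' =
      PiLp.homeomorph 2 (fun _ : Fin 2 => ℝ) ⁻¹' Icc ![p, p'] ![q, q'] := by
    ext x
    simp only [box, mem_ofPred_eq, mem_preimage, mem_Icc, Pi.le_def, Fin.forall_fin_two]
    simp only [Matrix.cons_val_zero, Matrix.cons_val_one]
    exact and_and_and_comm
  rw [h]
  exact (PiLp.homeomorph 2 (fun _ : Fin 2 => ℝ)).isCompact_preimage.2 isCompact_Icc

theorem mem_interior_box {p q p' q' : ℝ} {x : EuclideanSpace ℝ (Fin 2)} (h0 : p < x 0)
    (h1 : x 0 < q) (h2 : p' < x 1) (h3 : x 1 < q') : x ∈ interior (box p q p' q') := by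
  have c0 : Continuous fun x : EuclideanSpace ℝ (Fin 2) => x 0 := by fun_prop
  have c1 : Continuous fun x : EuclideanSpace ℝ (Fin 2) => x 1 := by fun_prop
  rw [mem_interior_iff_mem_nhds]
  filter_upwards [c0.continuousAt.eventually_const_lt h0, c0.continuousAt.eventually_lt_const h1,
    c1.continuousAt.eventually_const_lt h2, c1.continuousAt.eventually_lt_const h3]
    with y h0 h1 h2 h3 using ⟨⟨h0.le, h1.le⟩, h2.le, h3.le⟩

/-- One side of a box: either the velocity is negative, or there is room left before the wall. -/
theorem exists_pos_forall_add_mul_le {x k v : ℝ} (h : x ≤ k) (hv : x = k → v < 0) :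
    ∃ δ > 0, ∀ s ∈ Ioo (0 : ℝ) δ, ∀ w, |w - v| < δ → x + s * w ≤ k := by
  rcases lt_or_ge v 0 with h0 | h0
  · refine ⟨-v, by linarith, fun s hs w hw => ?_⟩
    have hw0 : w < 0 := by linarith [(abs_lt.1 hw).2]
    linarith [mul_neg_of_pos_of_neg hs.1 hw0]
  · have hlt : x < k := lt_of_le_of_ne h fun he => absurd (hv he) (not_lt.2 h0)
    have hv1 : 0 < v + 1 := by linarith
    refine ⟨min 1 ((k - x) / (v + 1)), lt_min one_pos (div_pos (by linarith) hv1),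
      fun s hs w hw => ?_⟩
    have hs' : s * (v + 1) < k - x :=
      (lt_div_iff₀ hv1).1 (hs.2.trans_le (min_le_right _ _))
    have hw' : w ≤ v + 1 := by linarith [(abs_lt.1 (hw.trans_le (min_le_left _ _))).2]
    linarith [mul_le_mul_of_nonneg_left hw' hs.1.le]

theorem pointsStrictlyInto_box {p q p' q' : ℝ} {x v : EuclideanSpace ℝ (Fin 2)}
    (hx : x ∈ box p q p' q') (h0 : x 0 = p → 0 < v 0) (h1 : x 0 = q → v 0 < 0)
    (h2 : x 1 = p' → 0 < v 1) (h3 : x 1 = q' → v 1 < 0) :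
    PointsStrictlyInto (box p q p' q') x v := by
  obtain ⟨d0, hd0, H0⟩ := exists_pos_forall_add_mul_le (x := -x 0) (k := -p) (v := -v 0)
    (neg_le_neg hx.1.1) fun h => neg_lt_zero.2 (h0 (neg_injective h))
  obtain ⟨d1, hd1, H1⟩ := exists_pos_forall_add_mul_le hx.1.2 h1
  obtain ⟨d2, hd2, H2⟩ := exists_pos_forall_add_mul_le (x := -x 1) (k := -p') (v := -v 1)
    (neg_le_neg hx.2.1) fun h => neg_lt_zero.2 (h2 (neg_injective h))
  obtain ⟨d3, hd3, H3⟩ := exists_pos_forall_add_mul_le hx.2.2 h3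
  refine ⟨min (min d0 d1) (min d2 d3), lt_min (lt_min hd0 hd1) (lt_min hd2 hd3),
    fun s hs w hw => ?_⟩
  have hcoord : ∀ i, |w i - v i| < min (min d0 d1) (min d2 d3) := by
    intro i
    refine lt_of_le_of_lt ?_ (mem_ball_iff_norm.1 hw)
    simpa using PiLp.norm_apply_le (w - v) i
  have hneg : ∀ i, |-w i - -v i| < min (min d0 d1) (min d2 d3) := by
    intro i
    rw [← neg_sub', abs_neg]
    exact hcoord i
  have m0 : min (min d0 d1) (min d2 d3) ≤ d0 := (min_le_left _ _).trans (min_le_left _ _)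
  have m1 : min (min d0 d1) (min d2 d3) ≤ d1 := (min_le_left _ _).trans (min_le_right _ _)
  have m2 : min (min d0 d1) (min d2 d3) ≤ d2 := (min_le_right _ _).trans (min_le_left _ _)
  have m3 : min (min d0 d1) (min d2 d3) ≤ d3 := (min_le_right _ _).trans (min_le_right _ _)
  have e0 := H0 s ⟨hs.1, hs.2.trans_le m0⟩ (-w 0) ((hneg 0).trans_le m0)
  have e1 := H1 s ⟨hs.1, hs.2.trans_le m1⟩ (w 0) ((hcoord 0).trans_le m1)
  have e2 := H2 s ⟨hs.1, hs.2.trans_le m2⟩ (-w 1) ((hneg 1).trans_le m2)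
  have e3 := H3 s ⟨hs.1, hs.2.trans_le m3⟩ (w 1) ((hcoord 1).trans_le m3)
  simp only [box, mem_ofPred_eq, PiLp.add_apply, PiLp.smul_apply, smul_eq_mul]
  exact ⟨⟨by linarith, e1⟩, by linarith, e3⟩

/-! ### The uniform gap -/

/-- The extension of `Λ` to `[-∞, ∞]` by its limits. -/
def extendShift (Λ : ℝ → ℝ) (lm lp : ℝ) : EReal → ℝ
  | ⊥ => lm
  | ⊤ => lp
  | (s : ℝ) => Λ s

section Gap

variable {Λ a c : ℝ → ℝ} {lm lp : ℝ}

theorem IsParameterShift.continuous_extendShift (hΛ : IsParameterShift Λ lm lp) :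
    Continuous (extendShift Λ lm lp) := by
  refine continuous_iff_continuousAt.2 fun s => ?_
  induction s with
  | bot =>
    rw [continuousAt_iff_punctured_nhds, EReal.nhdsWithin_bot, tendsto_map'_iff]
    exact hΛ.tendsto_atBot
  | top =>
    rw [continuousAt_iff_punctured_nhds, EReal.nhdsWithin_top, tendsto_map'_iff]
    exact hΛ.tendsto_atTop
  | coe s =>
    rw [ContinuousAt, EReal.nhds_coe, tendsto_map'_iff]
    exact hΛ.contDiff.continuous.tendsto s

theorem IsParameterShift.extendShift_mem_Icc (hΛ : IsParameterShift Λ lm lp) (s : EReal) :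
    extendShift Λ lm lp s ∈ Icc lm lp := by
  induction s with
  | bot => exact left_mem_Icc.2 hΛ.le
  | top => exact right_mem_Icc.2 hΛ.le
  | coe s => exact hΛ.mem_Icc s

/-- The triangle `s₁ ≤ s₂` in `[-∞, ∞]²` is compact and the gap extends continuously to it, so its
minimum is attained. The ordering hypotheses give positivity off the diagonal, and `hdiag` gives it
on the diagonal. -/
theorem IsParameterShift.exists_gap (hΛ : IsParameterShift Λ lm lp)
    (ha : ContinuousOn a (Icc lm lp)) (hc : ContinuousOn c (Icc lm lp))
    (hdiag : ∀ l ∈ Icc lm lp, 0 < a l + c l)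
    (h : ∀ s₁ s₂, s₁ < s₂ → 0 < a (Λ s₂) + c (Λ s₁)) (hbot : ∀ s₂, 0 < a (Λ s₂) + c lm)
    (htop : ∀ s₁, 0 < a lp + c (Λ s₁)) (hbt : 0 < a lp + c lm) :
    ∃ η > 0, ∀ s₁ s₂, s₁ ≤ s₂ → η ≤ a (Λ s₂) + c (Λ s₁) := by
  have hac := ha.comp_continuous hΛ.continuous_extendShift hΛ.extendShift_mem_Icc
  have hcc := hc.comp_continuous hΛ.continuous_extendShift hΛ.extendShift_mem_Icc
  have hcont : Continuous fun s : EReal × EReal =>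
      a (extendShift Λ lm lp s.2) + c (extendShift Λ lm lp s.1) :=
    (hac.comp continuous_snd).add (hcc.comp continuous_fst)
  have hcomp : IsCompact {s : EReal × EReal | s.1 ≤ s.2} :=
    (isClosed_le continuous_fst continuous_snd).isCompact
  obtain ⟨⟨x, y⟩, hxy, hmin⟩ := hcomp.exists_isMinOn ⟨(0, 0), by simp⟩ hcont.continuousOn
  refine ⟨_, ?_, fun s₁ s₂ hs => hmin (show ((s₁ : EReal), (s₂ : EReal)) ∈ _ from
    EReal.coe_le_coe_iff.2 hs)⟩
  simp only [mem_ofPred_eq] at hxy ⊢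
  rcases hxy.eq_or_lt with rfl | hlt
  · exact hdiag _ (hΛ.extendShift_mem_Icc _)
  · induction x with
    | top => exact absurd hlt not_top_lt
    | bot =>
      induction y with
      | bot => exact absurd hlt (lt_irrefl _)
      | top => exact hbt
      | coe y => exact hbot y
    | coe x =>
      induction y with
      | bot => exact absurd hlt not_lt_bot
      | top => exact htop x
      | coe y => exact h x y (EReal.coe_lt_coe_iff.1 hlt)

end Gap

/-! ### Forward inflowing stability of the lower equilibrium -/

/-- A barrier between the lower equilibrium and the saddle, increasing along the shift, with
uniform clearance `θ`. -/
structure IsSeparating (Λ a b : ℝ → ℝ) (lm lp θ : ℝ) (k : ℝ → ℝ) : Prop where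
  pos : 0 < θ
  le_one : θ ≤ 1
  mono : Monotone k
  lower : ∀ s, -√(b (Λ s) + 1) + θ ≤ k s
  upper : ∀ s, k s ≤ a (Λ s) - θ
  lower_bot : ∀ s, -√(b lm + 1) + θ ≤ k s
  upper_top : ∀ s, k s ≤ a lp - 2 * θ
  gap_top : -√(b lp + 1) + θ ≤ a lp - θ

section

variable {Λ a b : ℝ → ℝ} {lm lp : ℝ}

/-- The barrier is the running supremum of the lower equilibrium, raised by `2 * θ`. The supremum
over the past stays below every later saddle by `η ≥ 4 * θ`, which leaves clearance `2 * θ` on both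
sides. -/
theorem exists_isSeparating (hΛ : IsParameterShift Λ lm lp)
    (ha : ContinuousOn a (Icc lm lp)) (hb : ContinuousOn b (Icc lm lp))
    (hab : ∀ l ∈ Icc lm lp, |a l| < √(b l + 1))
    (h : ∀ s₁ s₂, s₁ < s₂ → -√(b (Λ s₁) + 1) < a (Λ s₂)) (hbot : ∀ s₂, -√(b lm + 1) < a (Λ s₂))
    (htop : ∀ s₁, -√(b (Λ s₁) + 1) < a lp) (hbt : -√(b lm + 1) < a lp) :
    ∃ θ k, IsSeparating Λ a b lm lp θ k := by
  have hc : ContinuousOn (fun l => √(b l + 1)) (Icc lm lp) := (hb.add continuousOn_const).sqrt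
  obtain ⟨η, hη, hgap⟩ := hΛ.exists_gap ha hc
    (fun l hl => by linarith [(abs_lt.1 (hab l hl)).1]) (fun s₁ s₂ hs => by linarith [h s₁ s₂ hs])
    (fun s => by linarith [hbot s]) (fun s => by linarith [htop s]) (by linarith)
  set θ := min (η / 4) 1 with hθ
  have hθη : θ ≤ η / 4 := min_le_left _ _
  have hθ0 : 0 < θ := lt_min (by linarith) one_pos
  set S : ℝ → Set ℝ := fun s => (fun s' => -√(b (Λ s') + 1)) '' Iic s with hS
  have hne : ∀ s, (S s).Nonempty := fun s => ⟨_, s, self_mem_Iic, rfl⟩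
  have hbdd : ∀ s, BddAbove (S s) := by
    rintro s
    refine ⟨0, ?_⟩
    rintro _ ⟨s', -, rfl⟩
    simp
  have hle : ∀ s' s, s' ≤ s → -√(b (Λ s') + 1) ≤ sSup (S s) := fun s' s hs =>
    le_csSup (hbdd s) ⟨s', hs, rfl⟩
  have hub : ∀ s s₂, s ≤ s₂ → sSup (S s) ≤ a (Λ s₂) - η := by
    intro s s₂ hs
    refine csSup_le (hne s) ?_
    rintro _ ⟨s', hs', rfl⟩
    simp only
    linarith [hgap s' s₂ (le_trans hs' hs)]
  refine ⟨θ, fun s => sSup (S s) + 2 * θ, hθ0, min_le_right _ _, fun s s' hs => ?_, fun s => ?_,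
    fun s => ?_, fun s => ?_, fun s => ?_, ?_⟩
  · have := csSup_le_csSup (hbdd s') (hne s) (image_mono (Iic_subset_Iic.2 hs))
    simpa using this
  · linarith [hle s s le_rfl]
  · linarith [hub s s le_rfl]
  · have : -√(b lm + 1) ≤ sSup (S s) := by
      refine le_of_tendsto (hΛ.tendsto_comp_atBot hc).neg ?_
      filter_upwards [eventually_le_atBot s] with s' hs' using hle s' s hs'
    linarith
  · have : sSup (S s) ≤ a lp - η := by
      refine ge_of_tendsto ((hΛ.tendsto_comp_atTop ha).sub_const η) ?_
      filter_upwards [eventually_ge_atTop s] with s' hs' using hub s s' hs'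
    linarith
  · have : η ≤ a lp + √(b lp + 1) :=
      ge_of_tendsto' ((hΛ.tendsto_comp_atTop ha).add (hΛ.tendsto_comp_atTop hc))
        fun s => hgap s s le_rfl
    linarith

theorem sqrt_le_of_abs_le {β B : ℝ} (h : |β| ≤ B) : √(β + 1) ≤ B + 1 := by
  have := abs_le.1 h
  have hB : 0 ≤ B := (abs_nonneg _).trans h
  rw [Real.sqrt_le_left (by linarith)]
  nlinarith

/-- The closed box ends at `a l - 2 * θ`, so its points start strictly below the barrier `a l - θ`,
which keeps them under the saddle. The a priori box is enlarged by `1` for the same strictness. -/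
theorem box_subset_basin {A B θ : ℝ} {l : ℝ} (hb1 : -1 < b l) (hab : |a l| < √(b l + 1))
    (hA : |a l| ≤ A) (hB : |b l| ≤ B) (hθ : 0 < θ) (hθ1 : θ ≤ 1)
    (hgap : -√(b l + 1) + θ ≤ a l - θ) :
    box (-(A + B + 2)) (a l - 2 * θ) (-(A + B + 2 + 1)) (a l - 2 * θ + θ ^ 3 / 2) ⊆
      basin (F a b) l (p₁ b l) := by
  intro x₀ hx₀
  have hB0 : 0 ≤ B := (abs_nonneg _).trans hB
  have hc : √(b l + 1) ^ 2 = b l + 1 := Real.sq_sqrt (by linarith)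
  have hA' := abs_le.1 hA
  have hθ3 : θ ^ 3 ≤ 1 := pow_le_one₀ hθ.le hθ1
  have hθ3' : 0 < θ ^ 3 := by positivity
  obtain ⟨u, v, hu0, hv0, hsol⟩ := exists_forall_ge_solvesAt (α := fun _ => a l) (β := fun _ => b l)
    continuous_const continuous_const (fun _ => hA) (fun _ => hB) 0 (x₀ 0) (x₀ 1)
  obtain ⟨⟨h1, h2⟩, h3, h4⟩ := hx₀
  have hbarrier : ∀ t, 0 ≤ t → u t ≤ a l - θ := fun t ht =>
    (lt_barrier (k := fun _ => a l - θ) (κ := 0) (e := θ ^ 3 / 2) (t₁ := t)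
      (fun s hs _ => hsol s hs) (by intros; simp) (by positivity)
      (fun s _ _ => by
        linarith [cubic_le_neg_pow_of_between hc (abs_lt.1 hab).2.le hθ.le hgap le_rfl])
      (by rw [hu0]; linarith) (by rw [hv0]; linarith) t ht le_rfl).1.le
  have hbox := abs_lt_of_solvesAt (M := A + B + 2 + 1) (fun _ => hA) (fun _ => hB) (by linarith)
    hsol (by rw [hu0, abs_lt]; constructor <;> linarith)
    (by rw [hv0, abs_lt]; constructor <;> linarith)
  obtain ⟨hu, hv⟩ := tendsto_neg_of_lt_saddle (M := A + B + 2 + 1 + 1) hc (Real.sqrt_nonneg _)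
    hab.le tendsto_const_nhds tendsto_const_nhds ((eventually_ge_atTop 0).mono hsol)
    ((eventually_ge_atTop 0).mono hbarrier) (by linarith)
    ((eventually_ge_atTop 0).mono fun t ht => by linarith [(hbox t ht).1])
    ((eventually_ge_atTop 0).mono fun t ht => (hbox t ht).2.le)
  refine ⟨fun t => !₂[u t, v t], ?_, fun t ht => ?_, tendsto_fin_two_iff.2 ⟨hu, hv⟩⟩
  · ext i
    fin_cases i
    · exact hu0
    · exact hv0
  · exact ((hasDerivAt_F_iff (lam := fun _ => l) (x := fun t => !₂[u t, v t])).2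
      (hsol t ht)).hasDerivWithinAt

theorem IsSeparating.isForwardInflowingStable {θ : ℝ} {k : ℝ → ℝ}
    (hk : IsSeparating Λ a b lm lp θ k) (hΛ : IsParameterShift Λ lm lp)
    (ha : ContinuousOn a (Icc lm lp)) (hb : ContinuousOn b (Icc lm lp))
    (hb1 : ∀ l ∈ Icc lm lp, -1 < b l) (hab : ∀ l ∈ Icc lm lp, |a l| < √(b l + 1)) :
    IsForwardInflowingStable (F a b) Λ lm lp (fun s => p₁ b (Λ s)) (p₁ b lm) (p₁ b lp) := by
  obtain ⟨A, hA⟩ := exists_abs_le_of_continuousOn_Icc ha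
  obtain ⟨B, hB⟩ := exists_abs_le_of_continuousOn_Icc hb
  have hlm := left_mem_Icc.2 hΛ.le
  have hlp := right_mem_Icc.2 hΛ.le
  have hA0 : 0 ≤ A := (abs_nonneg _).trans (hA _ hlm)
  have hθ := hk.pos
  have hθ3 : 0 < θ ^ 3 := by positivity
  set K : ℝ → Set (EuclideanSpace ℝ (Fin 2)) := fun s =>
    box (-(A + B + 2)) (k s) (-(A + B + 2 + 1)) (k s + θ ^ 3 / 2) with hK
  have hcB : ∀ l ∈ Icc lm lp, -(A + B + 2) < -√(b l + 1) := fun l hl => by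
    linarith [sqrt_le_of_abs_le (hB l hl)]
  have hint : ∀ l ∈ Icc lm lp, ∀ q, -√(b l + 1) < q →
      p₁ b l ∈ interior (box (-(A + B + 2)) q (-(A + B + 2 + 1)) (q + θ ^ 3 / 2)) := by
    intro l hl q hq
    have := hcB l hl
    apply mem_interior_box <;> simp only [p₁, PiLp.toLp_apply, Matrix.cons_val_zero,
      Matrix.cons_val_one] <;> linarith
  have hmono : ∀ {q q' : ℝ}, q ≤ q' →
      box (-(A + B + 2)) q (-(A + B + 2 + 1)) (q + θ ^ 3 / 2) ⊆
        box (-(A + B + 2)) q' (-(A + B + 2 + 1)) (q' + θ ^ 3 / 2) :=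
    fun h x hx => ⟨⟨hx.1.1, hx.1.2.trans h⟩, hx.2.1, by linarith [hx.2.2]⟩
  have hclo : closure (⋃ s, K s) ⊆
      box (-(A + B + 2)) (a lp - 2 * θ) (-(A + B + 2 + 1)) (a lp - 2 * θ + θ ^ 3 / 2) :=
    closure_minimal (iUnion_subset fun s => hmono (hk.upper_top s)) (isClosed_box _ _ _ _)
  refine ⟨isStablePath_p₁ hΛ hb hb1 hab, K, fun s => isCompact_box _ _ _ _,
    fun s => hint _ (hΛ.mem_Icc s) _ (by linarith [hk.lower s]),
    fun s₁ s₂ hs => hmono (hk.mono hs.le), fun s x hx => ?_, ?_, ?_, ?_, ?_⟩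
  · have hxK : x ∈ K s := (isClosed_box _ _ _ _).frontier_subset hx
    have hl := hΛ.mem_Icc s
    have hc : √(b (Λ s) + 1) ^ 2 = b (Λ s) + 1 := Real.sq_sqrt (by linarith [hb1 _ hl])
    have hF0 : F a b x (Λ s) 0 = cubic (a (Λ s)) (b (Λ s)) (x 0) - x 0 + x 1 := by
      simp only [F, PiLp.toLp_apply, Matrix.cons_val_zero, cubic]
      ring
    have hF1 : F a b x (Λ s) 1 = x 0 - x 1 := rfl
    obtain ⟨⟨h1, h2⟩, h3, h4⟩ := hxK
    refine pointsStrictlyInto_box ⟨⟨h1, h2⟩, h3, h4⟩ (fun h => ?_) (fun h => ?_) (fun h => ?_)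
      (fun h => ?_)
    · rw [hF0, h]
      linarith [two_le_cubic_neg (hA _ hl) (hB _ hl) le_rfl]
    · rw [hF0, h]
      linarith [cubic_le_neg_pow_of_between hc (abs_lt.1 (hab _ hl)).2.le hθ.le (hk.lower s)
        (hk.upper s)]
    · rw [hF1, h]
      linarith
    · rw [hF1, h]
      linarith
  -- One fixed box around the past limit lies in every `K s`.
  · refine interior_mono (subset_iInter fun s => ?_)
      (hint lm hlm (-√(b lm + 1) + θ) (by linarith))
    exact hmono (hk.lower_bot s)
  · have hlim : Tendsto (fun s => -√(b (Λ s) + 1)) atTop (𝓝 (-√(b lp + 1))) :=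
      (hΛ.tendsto_comp_atTop (hb.add continuousOn_const).sqrt).neg
    obtain ⟨s, hs⟩ := (hlim.eventually_const_lt
      (show -√(b lp + 1) - θ < -√(b lp + 1) by linarith)).exists
    exact interior_mono ((subset_iUnion K s).trans subset_closure)
      (hint lp hlp (k s) (by linarith [hk.lower s]))
  · exact (isCompact_box _ _ _ _).of_isClosed_subset isClosed_closure hclo
  · exact hclo.trans (box_subset_basin (hb1 lp hlp) (hab lp hlp) (hA lp hlp) (hB lp hlp) hθ
      hk.le_one hk.gap_top)

theorem cubic_neg_sqrt {α β : ℝ} (hβ : -1 < β) : cubic α β (-√(β + 1)) = 0 := by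
  have := cubic_neg (-α) β √(β + 1)
  rwa [neg_neg, cubic_sqrt hβ, neg_zero] at this

theorem cubicSlope_neg_sqrt_lt {α β : ℝ} (hβ : -1 < β) (h : |α| < √(β + 1)) :
    cubicSlope α β (-√(β + 1)) (-√(β + 1)) < -1 := by
  have := cubicSlope_sqrt_lt (α := -α) hβ (by rwa [abs_neg])
  unfold cubicSlope at *
  linarith

theorem IsSeparating.noRTipping {θ : ℝ} {k : ℝ → ℝ}
    (hk : IsSeparating Λ a b lm lp θ k) (hΛ : IsParameterShift Λ lm lp)
    (ha : ContinuousOn a (Icc lm lp)) (hb : ContinuousOn b (Icc lm lp))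
    (hb1 : ∀ l ∈ Icc lm lp, -1 < b l) (hab : ∀ l ∈ Icc lm lp, |a l| < √(b l + 1)) :
    NoRTipping (F a b) Λ (p₁ b lm) (p₁ b lp) := by
  intro r hr
  obtain ⟨A, hA⟩ := exists_abs_le_of_continuousOn_Icc ha
  obtain ⟨B, hB⟩ := exists_abs_le_of_continuousOn_Icc hb
  have hlm := left_mem_Icc.2 hΛ.le
  have hlp := right_mem_Icc.2 hΛ.le
  have hA0 : 0 ≤ A := (abs_nonneg _).trans (hA _ hlm)
  have hθ := hk.pos
  have hθ3 : 0 < θ ^ 3 := by positivity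
  obtain ⟨x, hx⟩ := exists_isPullbackAttractor hΛ ha hb hr (cubic_neg_sqrt (hb1 lm hlm))
    (cubicSlope_neg_sqrt_lt (hb1 lm hlm) (hab lm hlm))
  refine ⟨x, hx, ?_⟩
  have hsol := fun t => (hasDerivAt_F_iff (lam := fun t => Λ (r * t))).1 (hx.1.1 t)
  obtain ⟨hu, hv⟩ := tendsto_fin_two_iff.1 hx.1.2
  have hcB := sqrt_le_of_abs_le (hB lm hlm)
  have hc0 := Real.sqrt_nonneg (b lm + 1)
  have hM : |-√(b lm + 1)| < A + B + 2 := by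
    rw [abs_neg, abs_of_nonneg hc0]
    linarith
  -- Early enough the pullback attractor is below `-√(b lm + 1) + θ`, hence below the barrier at
  -- every parameter time.
  obtain ⟨t₀, h1, h2, h3, h4⟩ := ((hu.eventually_lt_const
      (show -√(b lm + 1) < -√(b lm + 1) + θ by linarith)).and ((hv.eventually_lt_const
      (show -√(b lm + 1) < -√(b lm + 1) + θ by linarith)).and
      ((hu.abs.eventually_lt_const hM).and (hv.abs.eventually_lt_const hM)))).exists
  have hbox := abs_lt_of_solvesAt (fun t => hA _ (hΛ.mem_Icc (r * t)))
    (fun t => hB _ (hΛ.mem_Icc (r * t))) le_rfl (fun t (_ : t₀ ≤ t) => hsol t) h3 (by linarith)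
  have hbarrier : ∀ t, t₀ ≤ t → x t 0 ≤ a lp - 2 * θ := by
    intro t ht
    -- A nondecreasing barrier allows `κ = 0` at every rate `r`.
    have := (lt_barrier (k := fun t => k (r * t)) (κ := 0) (e := θ ^ 3 / 2) (t₀ := t₀) (t₁ := t)
      (fun s _ _ => hsol s)
      (fun s s' _ hs _ => by
        have := hk.mono (mul_le_mul_of_nonneg_left hs hr.le)
        linarith) (by positivity)
      (fun s _ _ => by
        have hl := hΛ.mem_Icc (r * s)
        linarith [cubic_le_neg_pow_of_between
          (Real.sq_sqrt (by linarith [hb1 _ hl]) : √(b (Λ (r * s)) + 1) ^ 2 = _)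
          (abs_lt.1 (hab _ hl)).2.le hθ.le (hk.lower (r * s)) (hk.upper (r * s))])
      (by linarith [hk.lower_bot (r * t₀)]) (by linarith [hk.lower_bot (r * t₀)]) t ht le_rfl).1
    exact this.le.trans (hk.upper_top _)
  have hrt : Tendsto (fun t => r * t) atTop atTop := tendsto_id.const_mul_atTop hr
  exact tendsto_fin_two_iff.2 (tendsto_neg_of_lt_saddle (M := A + B + 2 + 1)
    (Real.sq_sqrt (by linarith [hb1 lp hlp])) (Real.sqrt_nonneg _) (hab lp hlp).le
    ((hΛ.tendsto_comp_atTop ha).comp hrt) ((hΛ.tendsto_comp_atTop hb).comp hrt)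
    (Eventually.of_forall hsol) ((eventually_ge_atTop t₀).mono hbarrier) (by linarith)
    ((eventually_ge_atTop t₀).mono fun t ht => by linarith [(hbox t ht).1])
    ((eventually_ge_atTop t₀).mono fun t ht => (hbox t ht).2.le))

end

/-! ### Tipping from the upper equilibrium -/

section

variable {Λ a b : ℝ → ℝ} {lm lp : ℝ}

theorem exists_abs_le_of_tendsto {f : ℝ → ℝ} {x y : ℝ} (hf : Continuous f)
    (hbot : Tendsto f atBot (𝓝 x)) (htop : Tendsto f atTop (𝓝 y)) : ∃ C, ∀ t, |f t| ≤ C := by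
  obtain ⟨s, hs⟩ := eventually_atBot.1 (hbot.abs.eventually_le_const (lt_add_one |x|))
  obtain ⟨t, ht⟩ := eventually_atTop.1 (htop.abs.eventually_le_const (lt_add_one |y|))
  obtain ⟨C, hC⟩ := (isCompact_Icc (a := s) (b := t)).exists_bound_of_continuousOn hf.continuousOn
  refine ⟨max C (max (|x| + 1) (|y| + 1)), fun z => ?_⟩
  rcases le_total z s with h1 | h1
  · exact (hs z h1).trans ((le_max_left _ _).trans (le_max_right _ _))
  rcases le_total t z with h2 | h2
  · exact (ht z h2).trans ((le_max_right _ _).trans (le_max_right _ _))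
  · exact (hC z ⟨h1, h2⟩).trans (le_max_left _ _)

/-- `Λ'` is continuous with limits at both ends, hence bounded. A drift at speed `ε` therefore moves
`f ∘ Λ` at a rate of at most `L * ε`. -/
theorem IsParameterShift.exists_abs_sub_le (hΛ : IsParameterShift Λ lm lp) {f : ℝ → ℝ}
    (hf : ContDiffOn ℝ 2 f (Icc lm lp)) :
    ∃ L > 0, ∀ s t, |f (Λ s) - f (Λ t)| ≤ L * |s - t| := by
  obtain ⟨K, hK⟩ := hf.exists_lipschitzOnWith two_ne_zero (convex_Icc _ _) isCompact_Icc
  obtain ⟨C, hC⟩ := exists_abs_le_of_tendsto (hΛ.contDiff.continuous_deriv (by norm_num))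
    hΛ.deriv_atBot hΛ.deriv_atTop
  have hC0 : 0 ≤ C := (abs_nonneg _).trans (hC 0)
  have hd : Differentiable ℝ Λ := hΛ.contDiff.differentiable two_ne_zero
  refine ⟨K * C + 1, by positivity, fun s t => ?_⟩
  have h1 := hK.dist_le_mul _ (hΛ.mem_Icc s) _ (hΛ.mem_Icc t)
  have h2 : |Λ s - Λ t| ≤ C * |s - t| :=
    convex_univ.norm_image_sub_le_of_norm_deriv_le (fun x _ => hd x) (fun x _ => hC x)
      (mem_univ t) (mem_univ s)
  rw [Real.dist_eq, Real.dist_eq] at h1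
  have h3 := mul_le_mul_of_nonneg_left h2 K.coe_nonneg
  linarith [abs_nonneg (s - t)]

/-! ### Time changes with a rapid passage -/

/-- The time change that runs at speed `ε`, except for a rush from `s₁` to `s₂` during
`[0, τ]`. -/
def rush (s₁ s₂ ε τ t : ℝ) : ℝ :=
  (s₂ - s₁ - ε * τ) * Real.smoothTransition (t / τ) + (s₁ + ε * t)

section Rush

variable {s₁ s₂ ε τ : ℝ}

theorem rush_of_nonpos (hτ : 0 < τ) {t : ℝ} (ht : t ≤ 0) : rush s₁ s₂ ε τ t = s₁ + ε * t := by
  rw [rush, Real.smoothTransition.zero_of_nonpos (div_nonpos_of_nonpos_of_nonneg ht hτ.le)]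
  ring

theorem rush_of_ge (hτ : 0 < τ) {t : ℝ} (ht : τ ≤ t) :
    rush s₁ s₂ ε τ t = s₂ + ε * (t - τ) := by
  rw [rush, Real.smoothTransition.one_of_one_le ((one_le_div hτ).2 ht)]
  ring

theorem contDiff_rush : ContDiff ℝ 2 (rush s₁ s₂ ε τ) := by
  unfold rush
  have h : ContDiff ℝ 2 Real.smoothTransition := Real.smoothTransition.contDiff
  exact (contDiff_const.mul (h.comp (contDiff_id.div_const τ))).add
    (contDiff_const.add (contDiff_const.mul contDiff_id))

theorem isRescaling_rush (hε : 0 < ε) (hτ : 0 < τ) (h : ε * τ < s₂ - s₁) :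
    IsRescaling (rush s₁ s₂ ε τ) where
  contDiff := contDiff_rush
  deriv_pos t := by
    have hmono : Monotone fun t => (s₂ - s₁ - ε * τ) * Real.smoothTransition (t / τ) :=
      (Real.smoothTransition.monotone.comp fun x y hxy =>
        div_le_div_of_nonneg_right hxy hτ.le).const_mul (by linarith)
    have hS : ContDiff ℝ 2 Real.smoothTransition := Real.smoothTransition.contDiff
    have hd : DifferentiableAt ℝ
        (fun t => (s₂ - s₁ - ε * τ) * Real.smoothTransition (t / τ)) t :=
      ((contDiff_const.mul (hS.comp (contDiff_id.div_const τ))).differentiable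
        two_ne_zero).differentiableAt
    have hlin : HasDerivAt (fun t : ℝ => s₁ + ε * t) ε t := by
      simpa using ((hasDerivAt_id t).const_mul ε).const_add s₁
    have := (hd.hasDerivAt.add hlin).deriv
    rw [show rush s₁ s₂ ε τ = (fun t => (s₂ - s₁ - ε * τ) * Real.smoothTransition (t / τ)) +
      fun t => s₁ + ε * t from rfl, this]
    linarith [hmono.deriv_nonneg (x := t)]
  tendsto_atBot := by
    refine Tendsto.congr' (f₁ := fun t => s₁ + ε * t) ?_ ?_
    · filter_upwards [eventually_le_atBot 0] with t ht using (rush_of_nonpos hτ ht).symm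
    · exact tendsto_atBot_add_const_left _ _ (tendsto_id.const_mul_atBot hε)
  tendsto_atTop := by
    refine Tendsto.congr' (f₁ := fun t => s₂ + ε * (t - τ)) ?_ ?_
    · filter_upwards [eventually_ge_atTop τ] with t ht using (rush_of_ge hτ ht).symm
    · exact tendsto_atTop_add_const_left _ _
        ((tendsto_atTop_add_const_right _ (-τ) tendsto_id).const_mul_atTop hε)

theorem deriv_rush_of_neg (hτ : 0 < τ) {t : ℝ} (ht : t < 0) :
    deriv (rush s₁ s₂ ε τ) t = ε := by
  have hlin : HasDerivAt (fun t : ℝ => s₁ + ε * t) ε t := by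
    simpa using ((hasDerivAt_id t).const_mul ε).const_add s₁
  refine (hlin.congr_of_eventuallyEq ?_).deriv
  filter_upwards [Iio_mem_nhds ht] with x hx using rush_of_nonpos hτ (le_of_lt hx)

theorem deriv_rush_of_gt (hτ : 0 < τ) {t : ℝ} (ht : τ < t) :
    deriv (rush s₁ s₂ ε τ) t = ε := by
  have hlin : HasDerivAt (fun t : ℝ => s₂ + ε * (t - τ)) ε t := by
    simpa using (((hasDerivAt_id t).sub_const τ).const_mul ε).const_add s₂
  refine (hlin.congr_of_eventuallyEq ?_).deriv
  filter_upwards [Ioi_mem_nhds ht] with x hx using rush_of_ge hτ (le_of_lt hx)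

theorem IsParameterShift.comp_rush (hΛ : IsParameterShift Λ lm lp) (hε : 0 < ε) (hτ : 0 < τ)
    (h : ε * τ < s₂ - s₁) : IsParameterShift (Λ ∘ rush s₁ s₂ ε τ) lm lp := by
  have hσ := isRescaling_rush hε hτ h
  have hder : ∀ t, deriv (Λ ∘ rush s₁ s₂ ε τ) t =
      deriv Λ (rush s₁ s₂ ε τ t) * deriv (rush s₁ s₂ ε τ) t := fun t =>
    deriv_comp t (hΛ.contDiff.differentiable two_ne_zero _)
      (contDiff_rush.differentiable two_ne_zero _)
  refine ⟨hΛ.contDiff.comp hσ.contDiff, fun s => hΛ.mem_Ioo _,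
    hΛ.tendsto_atBot.comp hσ.tendsto_atBot, hΛ.tendsto_atTop.comp hσ.tendsto_atTop, ?_, ?_⟩
  · have h1 : Tendsto (fun t => deriv Λ (rush s₁ s₂ ε τ t) * ε) atBot (𝓝 0) := by
      simpa using (hΛ.deriv_atBot.comp hσ.tendsto_atBot).mul_const ε
    refine h1.congr' ?_
    filter_upwards [eventually_lt_atBot 0] with t ht
    rw [hder, deriv_rush_of_neg hτ ht]
  · have h1 : Tendsto (fun t => deriv Λ (rush s₁ s₂ ε τ t) * ε) atTop (𝓝 0) := by
      simpa using (hΛ.deriv_atTop.comp hσ.tendsto_atTop).mul_const ε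
    refine h1.congr' ?_
    filter_upwards [eventually_gt_atTop τ] with t ht
    rw [hder, deriv_rush_of_gt hτ ht]

end Rush

/-- Three upper barriers are chained: `c + θ` up to time `0`, a rising line during `[0, τ]`, and `a
- θ` afterwards. The speed of the shift is built into `σ`, so the rate is `1`. -/
theorem rTippingPossible_p₃ (hΛ : IsParameterShift Λ lm lp)
    (ha : ContDiffOn ℝ 2 a (Icc lm lp)) (hb : ContDiffOn ℝ 2 b (Icc lm lp))
    (hb1 : ∀ l ∈ Icc lm lp, -1 < b l) (hab : ∀ l ∈ Icc lm lp, |a l| < √(b l + 1))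
    {s₁ s₂ : ℝ} (h12 : s₁ < s₂) (hcross : √(b (Λ s₁) + 1) < a (Λ s₂)) :
    RTippingPossible (F a b) Λ lm lp (fun s => p₃ b (Λ s)) (p₃ b lm) (p₃ b lp) := by
  refine ⟨isStablePath_p₃ hΛ hb.continuousOn hb1 hab, ?_⟩
  have hlm := left_mem_Icc.2 hΛ.le
  have hlp := right_mem_Icc.2 hΛ.le
  have hcC2 : ContDiffOn ℝ 2 (fun l => √(b l + 1)) (Icc lm lp) :=
    (hb.add contDiffOn_const).sqrt fun l hl => by linarith [hb1 l hl]
  have hsq : ∀ l ∈ Icc lm lp, √(b l + 1) ^ 2 = b l + 1 := fun l hl =>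
    Real.sq_sqrt (by linarith [hb1 l hl])
  obtain ⟨A, hA⟩ := exists_abs_le_of_continuousOn_Icc ha.continuousOn
  obtain ⟨B, hB⟩ := exists_abs_le_of_continuousOn_Icc hb.continuousOn
  have hA0 : 0 ≤ A := (abs_nonneg _).trans (hA _ hlm)
  have hB0 : 0 ≤ B := (abs_nonneg _).trans (hB _ hlm)
  obtain ⟨L, hL, hLc⟩ := hΛ.exists_abs_sub_le hcC2
  obtain ⟨L', hL', hLa⟩ := hΛ.exists_abs_sub_le ha
  -- the clearance of the barriers
  obtain ⟨l₀, hl₀, hmin⟩ := isCompact_Icc.exists_isMinOn (nonempty_Icc.2 hΛ.le)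
    (ha.continuousOn.add hcC2.continuousOn)
  have hg0 : 0 < a l₀ + √(b l₀ + 1) := by linarith [(abs_lt.1 (hab l₀ hl₀)).1]
  have hgap : ∀ l ∈ Icc lm lp, a l₀ + √(b l₀ + 1) ≤ a l + √(b l + 1) := fun l hl => hmin hl
  -- `3 * θ` is one `θ` above `c` before the rush, one gained during it, and one below the saddle
  -- after it; `2 * θ` is the room needed between `-c` and the saddle.
  obtain ⟨θ, hθ0, hθ1, hθg, hθd⟩ : ∃ θ > 0, θ ≤ 1 ∧ 2 * θ ≤ a l₀ + √(b l₀ + 1) ∧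
      3 * θ ≤ a (Λ s₂) - √(b (Λ s₁) + 1) := by
    refine ⟨min 1 (min ((a l₀ + √(b l₀ + 1)) / 2) ((a (Λ s₂) - √(b (Λ s₁) + 1)) / 3)),
      lt_min one_pos (lt_min (by linarith) (by linarith)), min_le_left _ _, ?_, ?_⟩
    · linarith [(min_le_right 1 (min ((a l₀ + √(b l₀ + 1)) / 2)
        ((a (Λ s₂) - √(b (Λ s₁) + 1)) / 3))).trans (min_le_left _ _)]
    · linarith [(min_le_right 1 (min ((a l₀ + √(b l₀ + 1)) / 2)
        ((a (Λ s₂) - √(b (Λ s₁) + 1)) / 3))).trans (min_le_right _ _)]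
  have hθ3 : 0 < θ ^ 3 := by positivity
  have hθ31 : θ ^ 3 ≤ 1 := pow_le_one₀ hθ0.le hθ1
  -- the duration of the rush and the speed of the drift
  set C := (B + 3 + A) * ((B + 3) ^ 2 + B + 1) + 2 with hC
  have hC0 : 0 < C := by positivity
  -- A barrier climbing at speed `C` gains exactly `θ` during the rush.
  set τ := θ / C with hτdef
  have hτ : 0 < τ := div_pos hθ0 hC0
  have hCτ : C * τ = θ := by rw [hτdef]; field_simp
  -- The slow barriers fall at rate at most `κ = θ ^ 3 / 4`, which fits both `κ < e` and `-θ ^ 3 + e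
  -- < -κ` with `e = θ ^ 3 / 2`.
  obtain ⟨ε, hε, hετ, hεL, hεL'⟩ : ∃ ε > 0, ε * τ < s₂ - s₁ ∧ L * ε ≤ θ ^ 3 / 4 ∧
      L' * ε ≤ θ ^ 3 / 4 := by
    have hev : ∀ {K y : ℝ}, 0 < y → ∀ᶠ ε in 𝓝[>] (0 : ℝ), K * ε < y := by
      intro K y hy
      have : Tendsto (fun ε : ℝ => K * ε) (𝓝 0) (𝓝 (K * 0)) := (continuous_const_mul K).tendsto 0
      rw [mul_zero] at this
      exact nhdsWithin_le_nhds (this.eventually_lt_const hy)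
    obtain ⟨ε, h0, h1, h2, h3⟩ := (eventually_mem_nhdsWithin.and
      ((hev (K := τ) (sub_pos.2 h12)).and ((hev (K := L) (y := θ ^ 3 / 4) (by positivity)).and
      (hev (K := L') (y := θ ^ 3 / 4) (by positivity))))).exists
    exact ⟨ε, h0, by linarith, h2.le, h3.le⟩
  set σ := rush s₁ s₂ ε τ with hσ
  have hshift := hΛ.comp_rush hε hτ hετ
  refine ⟨σ, isRescaling_rush hε hτ hετ, hshift, 1, one_pos, ?_⟩
  obtain ⟨x, hx⟩ := exists_isPullbackAttractor hshift ha.continuousOn hb.continuousOn one_pos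
    (cubic_sqrt (hb1 lm hlm)) (cubicSlope_sqrt_lt (hb1 lm hlm) (hab lm hlm))
  refine ⟨x, hx, fun hlim => ?_⟩
  have hsol : ∀ t, SolvesAt (fun t => a (Λ (σ t))) (fun t => b (Λ (σ t))) (fun t => x t 0)
      (fun t => x t 1) t := fun t => by
    refine (hasDerivAt_F_iff (lam := fun t => Λ (σ t))).1 ?_
    simpa using hx.1.1 t
  obtain ⟨hu, hv⟩ := tendsto_fin_two_iff.1 hx.1.2
  have hlow : ∀ t, t ≤ 0 → σ t = s₁ + ε * t := fun t ht => rush_of_nonpos hτ ht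
  have hhigh : ∀ t, τ ≤ t → σ t = s₂ + ε * (t - τ) := fun t ht => rush_of_ge hτ ht
  -- before the rush
  have hclim : Tendsto (fun t => √(b (Λ (σ t)) + 1)) atBot (𝓝 √(b lm + 1)) :=
    hshift.tendsto_comp_atBot hcC2.continuousOn
  obtain ⟨t₀, ht₀, hu₀, hv₀⟩ := ((eventually_le_atBot (0 : ℝ)).and
    ((hu.eventually_lt (hclim.add_const θ) (by linarith)).and
      (hv.eventually_lt (hclim.add_const θ) (by linarith)))).exists
  have hbefore := lt_barrier (k := fun t => √(b (Λ (σ t)) + 1) + θ) (κ := θ ^ 3 / 4)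
    (e := θ ^ 3 / 2) (t₀ := t₀) (t₁ := 0) (fun t _ _ => hsol t)
    (fun s t hs hst ht => by
      have h1 := (abs_le.1 (hLc (σ s) (σ t))).2
      rw [hlow s (hst.trans ht), hlow t ht, show s₁ + ε * s - (s₁ + ε * t) = -(ε * (t - s)) by ring,
        abs_neg, abs_of_nonneg (mul_nonneg hε.le (sub_nonneg.2 hst)), ← mul_assoc] at h1
      rw [hlow s (hst.trans ht), hlow t ht]
      linarith [mul_le_mul_of_nonneg_right hεL (sub_nonneg.2 hst)])
    (by linarith)
    (fun t _ _ => by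
      have hl := hΛ.mem_Icc (σ t)
      linarith [cubic_le_neg_pow_of_ge (hsq _ hl) (Real.sqrt_nonneg _)
        (abs_lt.1 (hab _ hl)).2.le hθ0.le le_rfl])
    hu₀ (by linarith) 0 ht₀ le_rfl
  have hσ0 : σ 0 = s₁ := by rw [hlow 0 le_rfl]; ring
  rw [hσ0] at hbefore
  -- during the rush
  have hcs₁ := sqrt_le_of_abs_le (hB _ (hΛ.mem_Icc s₁))
  have hcs₁' := Real.sqrt_nonneg (b (Λ s₁) + 1)
  -- Negative `κ` encodes a rising barrier: it need only outrun the cubic, wherever the equilibria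
  -- are. It stays below `B + 3`, the radius used in `C`.
  have hrush := lt_barrier (k := fun t => √(b (Λ s₁) + 1) + θ + C * t) (κ := -C)
    (e := θ ^ 3 / 2) (t₀ := 0) (t₁ := τ) (fun t _ _ => hsol t)
    (fun s t _ _ _ => by linarith) (by linarith)
    (fun t h0 h1 => by
      have hl := hΛ.mem_Icc (σ t)
      have hCt : 0 ≤ C * t := by positivity
      have hCt' : C * t ≤ θ := hCτ ▸ mul_le_mul_of_nonneg_left h1 hC0.le
      have := (abs_le.1 (abs_cubic_le (hA _ hl) (hB _ hl)
        (show |√(b (Λ s₁) + 1) + θ + C * t| ≤ B + 3 by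
          rw [abs_of_nonneg (by positivity)]; linarith))).2
      linarith)
    (by linarith [hbefore.1]) (by linarith [hbefore.2]) τ hτ.le le_rfl
  rw [hCτ] at hrush
  -- after the rush
  have hστ : σ τ = s₂ := by rw [hhigh τ le_rfl]; ring
  have hafter : ∀ t, τ ≤ t → x t 0 < a (Λ (σ t)) - θ := fun t ht =>
    (lt_barrier (k := fun t => a (Λ (σ t)) - θ) (κ := θ ^ 3 / 4)
      (e := θ ^ 3 / 2) (t₀ := τ) (t₁ := t) (fun t _ _ => hsol t)
      (fun s t hs hst _ => by
        have h1 := (abs_le.1 (hLa (σ s) (σ t))).2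
        rw [hhigh s hs, hhigh t (hs.trans hst),
          show s₂ + ε * (s - τ) - (s₂ + ε * (t - τ)) = -(ε * (t - s)) by ring,
          abs_neg, abs_of_nonneg (mul_nonneg hε.le (sub_nonneg.2 hst)), ← mul_assoc] at h1
        rw [hhigh s hs, hhigh t (hs.trans hst)]
        linarith [mul_le_mul_of_nonneg_right hεL' (sub_nonneg.2 hst)])
      (by linarith)
      (fun t _ _ => by
        have hl := hΛ.mem_Icc (σ t)
        linarith [cubic_le_neg_pow_of_between (hsq _ hl) (abs_lt.1 (hab _ hl)).2.le hθ0.le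
          (show -√(b (Λ (σ t)) + 1) + θ ≤ a (Λ (σ t)) - θ by linarith [hgap _ hl]) le_rfl])
      (by rw [hστ]; linarith [hrush.1]) (by rw [hστ]; linarith [hrush.2]) t ht le_rfl).1
  -- Convergence to the upper sink would put `c` below the saddle in the limit.
  have hend : √(b lp + 1) ≤ a lp - θ :=
    le_of_tendsto_of_tendsto (tendsto_fin_two_iff.1 hlim).1
      ((hshift.tendsto_comp_atTop ha.continuousOn).sub_const θ)
      ((eventually_ge_atTop τ).mono fun t ht => (hafter t ht).le)
  linarith [(abs_lt.1 (hab lp hlp)).2]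

end

end RTipping
end

/-! ### The four cases, two of them by reflection -/

theorem proposition6p1 (lm lp : ℝ) (hl : lm < lp)
    (Λ : ℝ → ℝ) (hΛ : RTipping.IsParameterShift Λ lm lp)
    (a b : ℝ → ℝ) (ha : ContDiffOn ℝ 2 a (Set.Icc lm lp)) (hb : ContDiffOn ℝ 2 b (Set.Icc lm lp))
    (hb1 : ∀ l ∈ Set.Icc lm lp, -1 < b l)
    (hab : ∀ l ∈ Set.Icc lm lp, |a l| < √(b l + 1)) :
    ((∃ s₁ s₂, s₁ < s₂ ∧ -√(b (Λ s₁) + 1) > a (Λ s₂)) →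
      RTipping.RTippingPossible (RTipping.F a b) Λ lm lp
        (fun s => RTipping.p₁ b (Λ s)) (RTipping.p₁ b lm) (RTipping.p₁ b lp)) ∧
    ((∃ s₁ s₂, s₁ < s₂ ∧ √(b (Λ s₁) + 1) < a (Λ s₂)) →
      RTipping.RTippingPossible (RTipping.F a b) Λ lm lp
        (fun s => RTipping.p₃ b (Λ s)) (RTipping.p₃ b lm) (RTipping.p₃ b lp)) ∧
    ((∀ s₁ s₂, s₁ < s₂ → -√(b (Λ s₁) + 1) < a (Λ s₂)) →
      (∀ s₂, -√(b lm + 1) < a (Λ s₂)) →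
      (∀ s₁, -√(b (Λ s₁) + 1) < a lp) →
      -√(b lm + 1) < a lp →
      RTipping.IsForwardInflowingStable (RTipping.F a b) Λ lm lp
        (fun s => RTipping.p₁ b (Λ s)) (RTipping.p₁ b lm) (RTipping.p₁ b lp) ∧
      RTipping.NoRTipping (RTipping.F a b) Λ (RTipping.p₁ b lm) (RTipping.p₁ b lp)) ∧
    ((∀ s₁ s₂, s₁ < s₂ → √(b (Λ s₁) + 1) > a (Λ s₂)) →
      (∀ s₂, √(b lm + 1) > a (Λ s₂)) →
      (∀ s₁, √(b (Λ s₁) + 1) > a lp) →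
      √(b lm + 1) > a lp →
      RTipping.IsForwardInflowingStable (RTipping.F a b) Λ lm lp
        (fun s => RTipping.p₃ b (Λ s)) (RTipping.p₃ b lm) (RTipping.p₃ b lp) ∧
      RTipping.NoRTipping (RTipping.F a b) Λ (RTipping.p₃ b lm) (RTipping.p₃ b lp)) := by
  have hab' : ∀ l ∈ Icc lm lp, |(-a) l| < √(b l + 1) := by simpa using hab
  refine ⟨?_, ?_, fun h1 h2 h3 h4 => ?_, fun h1 h2 h3 h4 => ?_⟩
  · rintro ⟨s₁, s₂, h12, h⟩
    have hp := (RTipping.rTippingPossible_p₃ (a := -a) hΛ ha.neg hb hb1 hab' h12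
      (by simp only [Pi.neg_apply]; linarith)).reflect (RTipping.F_reflect a b)
    simpa only [RTipping.p₃_eq_neg, neg_neg] using hp
  · rintro ⟨s₁, s₂, h12, h⟩
    exact RTipping.rTippingPossible_p₃ hΛ ha hb hb1 hab h12 h
  · obtain ⟨θ, k, hk⟩ := RTipping.exists_isSeparating hΛ ha.continuousOn hb.continuousOn hab
      h1 h2 h3 h4
    exact ⟨hk.isForwardInflowingStable hΛ ha.continuousOn hb.continuousOn hb1 hab,
      hk.noRTipping hΛ ha.continuousOn hb.continuousOn hb1 hab⟩
  · obtain ⟨θ, k, hk⟩ := RTipping.exists_isSeparating (a := -a) hΛ ha.continuousOn.neg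
      hb.continuousOn hab' (fun s₁ s₂ hs => neg_lt_neg (h1 s₁ s₂ hs)) (fun s => neg_lt_neg (h2 s))
      (fun s => neg_lt_neg (h3 s)) (neg_lt_neg h4)
    simp only [RTipping.p₃_eq_neg]
    exact ⟨(hk.isForwardInflowingStable hΛ ha.continuousOn.neg hb.continuousOn hb1
        hab').reflect (RTipping.F_reflect a b),
      (hk.noRTipping hΛ ha.continuousOn.neg hb.continuousOn hb1 hab').reflect
        (RTipping.F_reflect a b)⟩
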